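/- For a finite set $\Lambda\subseteq\mathbb{Z}^2$, let $\partial\Lambda$ be the set of sites of $\mathbb{Z}^2\setminus\Lambda$ that are nearest neighbors of some site of $\Lambda$, and let $\Sigma=\{-1,1\}^{\Lambda}$ and $\Gamma=\{-1,1\}^{\partial\Lambda}$. For $\sigma\in\Sigma$, a boundary condition $\gamma\in\Gamma$ and an external field $\phi\in\mathbb{R}^\Lambda$, let \[ H_{\gamma,\phi}(\sigma) = -\frac12\sum_{\substack{x,y\in\Lambda\\ x\sim y}}\sigma_x\sigma_y-\sum_{\substack{x\in\Lambda,\,y\in\partial\Lambda\\ x\sim y}}\sigma_x\gamma_y-\sum_{x\in\Lambda}\phi_x\sigma_x , \] where $x\sim y$ means that $x$ and $y$ are nearest neighbors and the first sum is over ordered pairs. For $\beta\in[0,\infty)$, let $\langle\sigma_x\rangle_\gamma$ be the expected value of $\sigma_x$ under the probability measure on $\Sigma$ with mass function proportional to $e^{-\beta H_{\gamma,\phi}(\sigma)}$; for $\beta=\infty$, let it be the expected value of $\sigma_x$ under the uniform probability measure on the set of minimizers of $H_{\gamma,\phi}$. There is a universal constant $C$ such that the following holds for every finite $\Lambda\subseteq\mathbb{Z}^2$,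 every $\beta\in[0,\infty]$, every $v>0$ and every $x\in\Lambda$ whose $\ell^\infty$ distance $n$ from $\partial\Lambda$ satisfies $n\ge 3$. If $(\phi_y)_{y\in\Lambda}$ are i.i.d. $N(0,v)$ random variables, then \[ \mathbb{E}\Bigl(\sup_{\gamma,\gamma'\in\Gamma}\bigl|\langle\sigma_x\rangle_\gamma-\langle\sigma_x\rangle_{\gamma'}\bigr|\Bigr)\le\frac{C(1+v^{-1/2})}{\sqrt{\log\log n}} . \] In particular, $C$ does not depend on $\beta$, and the bound holds for $\beta=\infty$. -/

import Mathlib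

open MeasureTheory ProbabilityTheory
open scoped NNReal ENNReal

noncomputable section

namespace RFIM

/-- The four nearest neighbors of a site of the square lattice `ℤ²`. -/
def neighbors (x : ℤ × ℤ) : Finset (ℤ × ℤ) :=
  {(x.1 + 1, x.2), (x.1 - 1, x.2), (x.1, x.2 + 1), (x.1, x.2 - 1)}

/-- Two sites are neighbors exactly when their `ℓ¹` distance is `1`. -/
theorem mem_neighbors {x y : ℤ × ℤ} :
    y ∈ neighbors x ↔ |x.1 - y.1| + |x.2 - y.2| = 1 := by
  obtain ⟨a, b⟩ := x
  obtain ⟨c, d⟩ := y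
  simp only [neighbors, Finset.mem_insert, Finset.mem_singleton, Prod.mk.injEq]
  rcases abs_cases (a - c) with h | h <;> rcases abs_cases (b - d) with h' | h' <;> omega

/-- The outer boundary `∂Λ`: the sites outside `Λ` that are adjacent to some site of `Λ`. -/
def outerBoundary (Λ : Finset (ℤ × ℤ)) : Finset (ℤ × ℤ) :=
  Λ.biUnion neighbors \ Λ

theorem mem_outerBoundary {Λ : Finset (ℤ × ℤ)} {y : ℤ × ℤ} :
    y ∈ outerBoundary Λ ↔ y ∉ Λ ∧ ∃ x ∈ Λ, y ∈ neighbors x := by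
  simp [outerBoundary, and_comm]

/-- Configurations, `Σ = {-1, 1}^Λ`; the unit group `ℤˣ` is the set `{-1, 1}`. -/
abbrev Config (Λ : Finset (ℤ × ℤ)) : Type := Λ → ℤˣ

/-- Boundary conditions, `Γ = {-1, 1}^∂Λ`. -/
abbrev BoundaryCondition (Λ : Finset (ℤ × ℤ)) : Type := outerBoundary Λ → ℤˣ

/-- The value of a spin as a real number, `1` or `-1`. -/
def spin (s : ℤˣ) : ℝ := ((s : ℤ) : ℝ)

/-- The energy `H_{γ,φ}(σ)`. The first double sum runs over ordered pairs, hence the `1 / 2`. -/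
def energy (Λ : Finset (ℤ × ℤ)) (γ : BoundaryCondition Λ) (φ : Λ → ℝ) (σ : Config Λ) : ℝ :=
  - (1 / 2) * (∑ x : Λ, ∑ y : Λ,
      if (y : ℤ × ℤ) ∈ neighbors x then spin (σ x) * spin (σ y) else 0)
  - (∑ x : Λ, ∑ y : outerBoundary Λ,
      if (y : ℤ × ℤ) ∈ neighbors x then spin (σ x) * spin (γ y) else 0)
  - ∑ x : Λ, φ x * spin (σ x)

open Classical in
/-- The unnormalized weight of `σ` at inverse temperature `β ∈ [0, ∞]`: `exp (-β H(σ))` if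
`β < ∞`, and the indicator of the ground states (the minimizers of the energy) if `β = ∞`. -/
def weight (Λ : Finset (ℤ × ℤ)) (β : ℝ≥0∞) (γ : BoundaryCondition Λ) (φ : Λ → ℝ)
    (σ : Config Λ) : ℝ :=
  if β = ∞ then
    if ∀ τ : Config Λ, energy Λ γ φ σ ≤ energy Λ γ φ τ then 1 else 0
  else
    Real.exp (-β.toReal * energy Λ γ φ σ)

/-- The probability mass function of the Ising model on `Λ` at inverse temperature `β`, with
boundary condition `γ` and external field `φ`. -/
def isingProb (Λ : Finset (ℤ × ℤ)) (β : ℝ≥0∞) (γ : BoundaryCondition Λ) (φ : Λ → ℝ)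
    (σ : Config Λ) : ℝ :=
  weight Λ β γ φ σ / ∑ τ : Config Λ, weight Λ β γ φ τ

/-- The expected value `⟨σ_x⟩_γ` of the spin at `x` in the Ising model, for a given external
field `φ` (the quenched expectation, when `φ` is random). -/
def meanSpin (Λ : Finset (ℤ × ℤ)) (β : ℝ≥0∞) (γ : BoundaryCondition Λ) (φ : Λ → ℝ)
    (x : Λ) : ℝ :=
  ∑ σ : Config Λ, isingProb Λ β γ φ σ * spin (σ x)

/-- The maximal effect `sup_{γ,γ'} |⟨σ_x⟩_γ - ⟨σ_x⟩_γ'|` of the boundary condition on the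
expected spin at `x`; the supremum is over a finite nonempty set of pairs. -/
def boundaryEffect (Λ : Finset (ℤ × ℤ)) (β : ℝ≥0∞) (φ : Λ → ℝ) (x : Λ) : ℝ :=
  ⨆ p : BoundaryCondition Λ × BoundaryCondition Λ,
    |meanSpin Λ β p.1 φ x - meanSpin Λ β p.2 φ x|

end RFIM

end

/-!
The proof compares the plus and the minus boundary condition on boxes. By the four functions
theorem, mean spins are monotone in the boundary condition and in the domain
(`meanSpin_le_plus`, `minus_le_meanSpin`), so the boundary effect at `x` in `Λ` is at most the gap
`⟨σ_x⟩₊ - ⟨σ_x⟩₋` in any box around `x` inside `Λ`, and gaps decrease when the box grows.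
Let `a r` be the expected gap at the center of a box of radius `r`.

Two facts conflict if `a` does not decay.

* *Surface tension.* In a box `Q` of radius `L`, the sum over `Q` of the gaps is the derivative,
  under a uniform shift of the field, of the difference of the plus and minus free energies, which
  is of order `L`. Hence the average of the gaps over `Q`, integrated over all shifts, is `O(1 / L)`
  (`integral_sum_meanSpin_sub_le`). A shift by `s √v / (2 L + 1)` is a shift of the Gaussian field
  by `s` standard deviations, and costs a factor `exp (s ^ 2)` in probabilities
  (`pi_gaussian_shift_le`). So if the average gap is at least `δ / 2` outside an event of
  probability below `exp (-s ^ 2) / 4`, where `s` is of order `1 / (δ √v)`, there is a contradiction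
  (`mul_le_of_measure_average_gap_lt_le`).
* *Concentration.* The gaps in boxes of radius `r` around the sites of `Q` depend on the field in
  those boxes only, so their average has variance `O((r / L) ^ 2)`. If `a r` and `a (2 L)` nearly
  agree, the average of the smaller gaps at scale `2 L`, which bounds the average of the gaps in
  `Q` from below, is close to it in mean (`measure_average_gap_lt_le`).

Since `a` is monotone and bounded, among the scales `2 ^ (i M)` with `i < M` there is one where it
drops by at most `2 / M` up to the next one. With `δ = a (2 ^ M ^ 2)`, the exceptional probability
is then `O(1 / (δ ^ 2 M))`, and the comparison with `exp (-O(1 / (δ ^ 2 v)))` gives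
`δ ^ 2 log M = O(1 + 1 / v)` (`meanGap_sq_mul_log_le`). This is the claim for `β < ∞`, as `log M` is
of order `log log n` if `2 ^ M ^ 2` is the largest such scale below `n`. No constant depends on
`β`, so the bound passes to the limit `β → ∞` by dominated convergence.
-/

noncomputable section

namespace RFIM

/-! ### Spins and weights -/

lemma spin_inf_add_spin_sup (a b : ℤˣ) : spin (a ⊓ b) + spin (a ⊔ b) = spin a + spin b := by
  rcases Int.units_eq_one_or a with rfl | rfl <;>
    rcases Int.units_eq_one_or b with rfl | rfl <;> simp [spin]

lemma spin_mul_add_spin_mul_le (a b c d : ℤˣ) :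
    spin a * spin c + spin b * spin d
      ≤ spin (a ⊓ b) * spin (c ⊓ d) + spin (a ⊔ b) * spin (c ⊔ d) := by
  rcases Int.units_eq_one_or a with rfl | rfl <;> rcases Int.units_eq_one_or b with rfl | rfl <;>
    rcases Int.units_eq_one_or c with rfl | rfl <;>
      rcases Int.units_eq_one_or d with rfl | rfl <;> simp [spin] <;> norm_num

@[simp] lemma spin_one : spin 1 = 1 := by simp [spin]

@[simp] lemma spin_neg (a : ℤˣ) : spin (-a) = -spin a := by simp [spin]

lemma abs_spin (a : ℤˣ) : |spin a| = 1 := by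
  rcases Int.units_eq_one_or a with rfl | rfl <;> simp

lemma le_one_units (a : ℤˣ) : a ≤ 1 := by
  rcases Int.units_eq_one_or a with rfl | rfl <;> decide

lemma spin_mono {a b : ℤˣ} (h : a ≤ b) : spin a ≤ spin b := by
  rcases Int.units_eq_one_or a with rfl | rfl <;>
    rcases Int.units_eq_one_or b with rfl | rfl <;> simp_all [spin]
  · exact absurd h (by decide)

variable {Λ : Finset (ℤ × ℤ)} {β : ℝ≥0∞}

lemma weight_of_ne_top (hβ : β ≠ ∞) (γ : BoundaryCondition Λ) (φ : Λ → ℝ) (σ : Config Λ) :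
    weight Λ β γ φ σ = Real.exp (-β.toReal * energy Λ γ φ σ) := by
  simp [weight, hβ]

lemma weight_pos (hβ : β ≠ ∞) (γ : BoundaryCondition Λ) (φ : Λ → ℝ) (σ : Config Λ) :
    0 < weight Λ β γ φ σ := by
  rw [weight_of_ne_top hβ]
  positivity

/-- The partition function. -/
def partitionFn (Λ : Finset (ℤ × ℤ)) (β : ℝ≥0∞) (γ : BoundaryCondition Λ) (φ : Λ → ℝ) : ℝ :=
  ∑ σ : Config Λ, weight Λ β γ φ σ

lemma partitionFn_pos (β : ℝ≥0∞) (γ : BoundaryCondition Λ) (φ : Λ → ℝ) :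
    0 < partitionFn Λ β γ φ := by
  by_cases hβ : β = ∞
  · obtain ⟨σ, hσ⟩ := Finite.exists_min (energy Λ γ φ)
    refine Finset.sum_pos' (fun τ _ => ?_) ⟨σ, Finset.mem_univ _, ?_⟩
    · simp only [weight, hβ, if_true]; split_ifs <;> norm_num
    · simp [weight, hβ, hσ]
  · exact Finset.sum_pos (fun σ _ => weight_pos hβ γ φ σ) Finset.univ_nonempty

lemma weight_nonneg (β : ℝ≥0∞) (γ : BoundaryCondition Λ) (φ : Λ → ℝ) (σ : Config Λ) :
    0 ≤ weight Λ β γ φ σ := by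
  by_cases hβ : β = ∞
  · simp only [weight, hβ, if_true]; split_ifs <;> norm_num
  · exact (weight_pos hβ γ φ σ).le

lemma meanSpin_eq_div (β : ℝ≥0∞) (γ : BoundaryCondition Λ) (φ : Λ → ℝ) (x : Λ) :
    meanSpin Λ β γ φ x
      = (∑ σ : Config Λ, weight Λ β γ φ σ * spin (σ x)) / partitionFn Λ β γ φ := by
  simp only [meanSpin, isingProb, partitionFn, Finset.sum_div]
  exact Finset.sum_congr rfl fun σ _ => by ring

lemma abs_meanSpin_le_one (β : ℝ≥0∞) (γ : BoundaryCondition Λ) (φ : Λ → ℝ) (x : Λ) :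
    |meanSpin Λ β γ φ x| ≤ 1 := by
  rw [meanSpin_eq_div, abs_div, abs_of_pos (partitionFn_pos β γ φ),
    div_le_one (partitionFn_pos β γ φ)]
  refine (Finset.abs_sum_le_sum_abs _ _).trans (Finset.sum_le_sum fun σ _ => ?_)
  rw [abs_mul, abs_spin, mul_one, abs_of_nonneg (weight_nonneg β γ φ σ)]

/-! ### Ferromagnetic monotonicity -/

/-- Submodularity of the energy, jointly in the configuration and the boundary condition. -/
lemma energy_inf_add_energy_sup_le {γ γ' : BoundaryCondition Λ} (hγ : γ ≤ γ') (φ : Λ → ℝ)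
    (a b : Config Λ) :
    energy Λ γ φ (a ⊓ b) + energy Λ γ' φ (a ⊔ b) ≤ energy Λ γ φ a + energy Λ γ' φ b := by
  have h1 : (∑ x : Λ, ∑ y : Λ,
        if (y : ℤ × ℤ) ∈ neighbors x then spin (a x) * spin (a y) else 0)
      + (∑ x : Λ, ∑ y : Λ, if (y : ℤ × ℤ) ∈ neighbors x then spin (b x) * spin (b y) else 0)
      ≤ (∑ x : Λ, ∑ y : Λ,
        if (y : ℤ × ℤ) ∈ neighbors x then spin ((a ⊓ b) x) * spin ((a ⊓ b) y) else 0)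
      + (∑ x : Λ, ∑ y : Λ,
        if (y : ℤ × ℤ) ∈ neighbors x then spin ((a ⊔ b) x) * spin ((a ⊔ b) y) else 0) := by
    simp only [← Finset.sum_add_distrib]
    refine Finset.sum_le_sum fun x _ => Finset.sum_le_sum fun y _ => ?_
    split_ifs
    · exact spin_mul_add_spin_mul_le _ _ _ _
    · simp
  have h2 : (∑ x : Λ, ∑ y : outerBoundary Λ,
        if (y : ℤ × ℤ) ∈ neighbors x then spin (a x) * spin (γ y) else 0)
      + (∑ x : Λ, ∑ y : outerBoundary Λ,
        if (y : ℤ × ℤ) ∈ neighbors x then spin (b x) * spin (γ' y) else 0)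
      ≤ (∑ x : Λ, ∑ y : outerBoundary Λ,
        if (y : ℤ × ℤ) ∈ neighbors x then spin ((a ⊓ b) x) * spin (γ y) else 0)
      + (∑ x : Λ, ∑ y : outerBoundary Λ,
        if (y : ℤ × ℤ) ∈ neighbors x then spin ((a ⊔ b) x) * spin (γ' y) else 0) := by
    simp only [← Finset.sum_add_distrib]
    refine Finset.sum_le_sum fun x _ => Finset.sum_le_sum fun y _ => ?_
    split_ifs
    · have := spin_mul_add_spin_mul_le (a x) (b x) (γ y) (γ' y)
      rwa [inf_eq_left.2 (hγ y), sup_eq_right.2 (hγ y)] at this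
    · simp
  have h3 : (∑ x : Λ, φ x * spin ((a ⊓ b) x)) + (∑ x : Λ, φ x * spin ((a ⊔ b) x))
      = (∑ x : Λ, φ x * spin (a x)) + ∑ x : Λ, φ x * spin (b x) := by
    simp only [← Finset.sum_add_distrib, ← mul_add]
    exact Finset.sum_congr rfl fun x _ => by
      rw [Pi.inf_apply, Pi.sup_apply, spin_inf_add_spin_sup]
  simp only [energy]
  linarith

open scoped FinsetFamily in
/-- Conditioning the larger boundary condition on a family `t` of configurations that is closed
under taking suprema with arbitrary configurations raises the mean spin. -/
lemma sum_weight_spin_mul_le (hβ : β ≠ ∞) {γ γ' : BoundaryCondition Λ} (hγ : γ ≤ γ')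
    (φ : Λ → ℝ) (x : Λ) (t : Finset (Config Λ)) (ht : ∀ a, ∀ b ∈ t, a ⊔ b ∈ t) :
    (∑ σ, weight Λ β γ φ σ * spin (σ x)) * ∑ σ ∈ t, weight Λ β γ' φ σ
      ≤ partitionFn Λ β γ φ * ∑ σ ∈ t, weight Λ β γ' φ σ * spin (σ x) := by
  classical
  have hs : ∀ a : ℤˣ, 0 ≤ 1 + spin a := fun a => by
    have := abs_le.1 (abs_spin a).le
    linarith [this.1]
  have hw := fun γ σ => weight_nonneg (Λ := Λ) β γ φ σ
  have key := four_functions_theorem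
    (fun σ => weight Λ β γ φ σ * (1 + spin (σ x))) (fun σ => weight Λ β γ' φ σ)
    (fun σ => weight Λ β γ φ σ) (fun σ => weight Λ β γ' φ σ * (1 + spin (σ x)))
    (fun σ => mul_nonneg (hw _ _) (hs _)) (fun σ => hw _ _) (fun σ => hw _ _)
    (fun σ => mul_nonneg (hw _ _) (hs _)) (fun a b => ?_) Finset.univ t
  · have hsub : Finset.univ ⊻ t ⊆ t := by
      intro c hc
      obtain ⟨a, -, b, hb, rfl⟩ := Finset.mem_sups.1 hc
      exact ht a b hb
    have h3 : ∑ σ ∈ Finset.univ ⊼ t, weight Λ β γ φ σ ≤ partitionFn Λ β γ φ :=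
      Finset.sum_le_sum_of_subset_of_nonneg (Finset.subset_univ _) fun σ _ _ => hw _ _
    have h4 : ∑ σ ∈ Finset.univ ⊻ t, weight Λ β γ' φ σ * (1 + spin (σ x))
        ≤ ∑ σ ∈ t, weight Λ β γ' φ σ * (1 + spin (σ x)) :=
      Finset.sum_le_sum_of_subset_of_nonneg hsub fun σ _ _ => mul_nonneg (hw _ _) (hs _)
    have key' := key.trans (mul_le_mul h3 h4
      (Finset.sum_nonneg fun σ _ => mul_nonneg (hw _ _) (hs _)) (partitionFn_pos β γ φ).le)
    simp only [mul_add, mul_one, Finset.sum_add_distrib, add_mul] at key'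
    simp only [partitionFn] at key' ⊢
    linarith
  · have h1 : weight Λ β γ φ a * weight Λ β γ' φ b
        ≤ weight Λ β γ φ (a ⊓ b) * weight Λ β γ' φ (a ⊔ b) := by
      simp only [weight_of_ne_top hβ, ← Real.exp_add]
      refine Real.exp_le_exp.2 ?_
      have := mul_le_mul_of_nonneg_left (energy_inf_add_energy_sup_le hγ φ a b)
        (ENNReal.toReal_nonneg (a := β))
      linarith
    have h2 : spin (a x) ≤ spin ((a ⊔ b) x) := spin_mono le_sup_left
    calc weight Λ β γ φ a * (1 + spin (a x)) * weight Λ β γ' φ b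
        = (weight Λ β γ φ a * weight Λ β γ' φ b) * (1 + spin (a x)) := by ring
      _ ≤ (weight Λ β γ φ (a ⊓ b) * weight Λ β γ' φ (a ⊔ b)) * (1 + spin ((a ⊔ b) x)) :=
          mul_le_mul h1 (by linarith) (hs _) (mul_nonneg (hw _ _) (hw _ _))
      _ = _ := by ring

/-- Minus the energy of the restriction to `Λ` of a configuration `s` on the whole lattice, with
the boundary condition given by `s`. The sum over pairs runs over a window `W` large enough to
contain `Λ` and its boundary, and counts the pairs that meet `Λ`. -/
def windowEnergy (W Λ : Finset (ℤ × ℤ)) (φ : ℤ × ℤ → ℝ) (s : ℤ × ℤ → ℤˣ) : ℝ :=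
  (∑ x ∈ W, ∑ y ∈ W,
    if y ∈ neighbors x ∧ (x ∈ Λ ∨ y ∈ Λ) then spin (s x) * spin (s y) / 2 else 0)
  + ∑ x ∈ W, if x ∈ Λ then φ x * spin (s x) else 0

lemma mem_neighbors_comm {x y : ℤ × ℤ} : y ∈ neighbors x ↔ x ∈ neighbors y := by
  rw [mem_neighbors, mem_neighbors, abs_sub_comm, abs_sub_comm x.2]

lemma energy_eq_neg_windowEnergy {W : Finset (ℤ × ℤ)} (hΛ : Λ ⊆ W) (hW : outerBoundary Λ ⊆ W)
    (φ : ℤ × ℤ → ℝ) (s : ℤ × ℤ → ℤˣ) :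
    energy Λ (fun y => s y) (fun y => φ y) (fun y => s y) = -windowEnergy W Λ φ s := by
  have hsum : ∀ {V : Finset (ℤ × ℤ)} (_ : V ⊆ W) (f : ℤ × ℤ → ℝ),
      ∑ x : V, f x = ∑ x ∈ W, if x ∈ V then f x else 0 := by
    intro V hV f
    rw [Finset.sum_coe_sort V f, Finset.sum_ite_mem, Finset.inter_eq_right.2 hV]
  have h1 : (∑ x : Λ, ∑ y : Λ,
        if (y : ℤ × ℤ) ∈ neighbors x then spin (s x) * spin (s y) else 0)
      = ∑ x ∈ W, ∑ y ∈ W, if x ∈ Λ then (if y ∈ Λ then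
          (if y ∈ neighbors x then spin (s x) * spin (s y) else 0) else 0) else 0 := by
    rw [hsum hΛ fun x => ∑ y : Λ, if (y : ℤ × ℤ) ∈ neighbors x then spin (s x) * spin (s y) else 0]
    refine Finset.sum_congr rfl fun x _ => ?_
    split_ifs with hx
    · exact hsum hΛ fun y => if y ∈ neighbors x then spin (s x) * spin (s y) else 0
    · simp
  have h2 : (∑ x : Λ, ∑ y : outerBoundary Λ,
        if (y : ℤ × ℤ) ∈ neighbors x then spin (s x) * spin (s y) else 0)
      = ∑ x ∈ W, ∑ y ∈ W, if x ∈ Λ then (if y ∈ outerBoundary Λ then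
          (if y ∈ neighbors x then spin (s x) * spin (s y) else 0) else 0) else 0 := by
    rw [hsum hΛ fun x => ∑ y : outerBoundary Λ,
      if (y : ℤ × ℤ) ∈ neighbors x then spin (s x) * spin (s y) else 0]
    refine Finset.sum_congr rfl fun x _ => ?_
    split_ifs with hx
    · exact hsum hW fun y => if y ∈ neighbors x then spin (s x) * spin (s y) else 0
    · simp
  -- each pair with one site in `Λ` is counted once in the boundary sum, twice in the window
  have h3 := Finset.sum_comm (s := W) (t := W) (f := fun x y => if x ∈ Λ then
    (if y ∈ outerBoundary Λ then
      (if y ∈ neighbors x then spin (s x) * spin (s y) else 0) else 0) else 0)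
  have h4 : (∑ x ∈ W, ∑ y ∈ W,
        if y ∈ neighbors x ∧ (x ∈ Λ ∨ y ∈ Λ) then spin (s x) * spin (s y) / 2 else 0)
      = ∑ x ∈ W, ∑ y ∈ W, ((1 / 2) * (if x ∈ Λ then (if y ∈ Λ then
          (if y ∈ neighbors x then spin (s x) * spin (s y) else 0) else 0) else 0)
        + (1 / 2) * (if x ∈ Λ then (if y ∈ outerBoundary Λ then
          (if y ∈ neighbors x then spin (s x) * spin (s y) else 0) else 0) else 0)
        + (1 / 2) * (if y ∈ Λ then (if x ∈ outerBoundary Λ then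
          (if x ∈ neighbors y then spin (s y) * spin (s x) else 0) else 0) else 0)) := by
    refine Finset.sum_congr rfl fun x _ => Finset.sum_congr rfl fun y _ => ?_
    by_cases hxy : y ∈ neighbors x
    · have hyx := mem_neighbors_comm.1 hxy
      by_cases hx : x ∈ Λ <;> by_cases hy : y ∈ Λ
      · simp [hxy, hx, hy, mem_outerBoundary]; ring
      · have : y ∈ outerBoundary Λ := mem_outerBoundary.2 ⟨hy, x, hx, hxy⟩
        simp [hxy, hx, hy, this]; ring
      · have : x ∈ outerBoundary Λ := mem_outerBoundary.2 ⟨hx, y, hy, hyx⟩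
        simp [hxy, hyx, hx, hy, this]; ring
      · simp [hx, hy]
    · simp [hxy, mt mem_neighbors_comm.2 hxy]
  simp only [Finset.sum_add_distrib, ← Finset.mul_sum] at h4
  have h5 : (∑ x : Λ, φ x * spin (s x)) = ∑ x ∈ W, if x ∈ Λ then φ x * spin (s x) else 0 :=
    hsum hΛ fun x => φ x * spin (s x)
  simp only [energy, windowEnergy]
  rw [h1, h2, h4, h5, ← h3]
  ring

/-- The energies of nested domains have the same increments under changes in the smaller one. -/
lemma windowEnergy_sub {W B : Finset (ℤ × ℤ)} (hB : B ⊆ Λ) (φ : ℤ × ℤ → ℝ)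
    {s s' : ℤ × ℤ → ℤˣ} (hs : ∀ y ∉ B, s y = s' y) :
    windowEnergy W Λ φ s - windowEnergy W B φ s
      = windowEnergy W Λ φ s' - windowEnergy W B φ s' := by
  simp only [windowEnergy, add_sub_add_comm, ← Finset.sum_sub_distrib]
  congr 1
  · refine Finset.sum_congr rfl fun x _ => Finset.sum_congr rfl fun y _ => ?_
    by_cases hx : x ∈ B
    · simp [hx, hB hx]
    · by_cases hy : y ∈ B
      · simp [hy, hB hy]
      · rw [hs x hx, hs y hy]
  · refine Finset.sum_congr rfl fun x _ => ?_
    by_cases hx : x ∈ B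
    · simp [hx, hB hx]
    · rw [hs x hx]

/-- Mean spins increase when the domain shrinks and the new boundary condition is all plus. -/
theorem meanSpin_le_plus (hβ : β ≠ ∞) {B : Finset (ℤ × ℤ)} (hB : B ⊆ Λ)
    (γ : BoundaryCondition Λ) (φ : ℤ × ℤ → ℝ) {x : ℤ × ℤ} (hx : x ∈ B) :
    meanSpin Λ β γ (fun y => φ y) ⟨x, hB hx⟩ ≤ meanSpin B β 1 (fun y => φ y) ⟨x, hx⟩ := by
  classical
  -- extension of configurations on `B` by plus spins, first to the lattice, then to `Λ`
  let g : Config B → ℤ × ℤ → ℤˣ := fun b y => if h : y ∈ B then b ⟨y, h⟩ else 1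
  let ext : Config B → Config Λ := fun b y => g b y
  have hext : Function.Injective ext := by
    intro b b' h
    ext y : 1
    simpa [ext, g] using congrFun h ⟨y, hB y.2⟩
  have ht : ∀ a, ∀ b ∈ Finset.univ.image ext, a ⊔ b ∈ Finset.univ.image ext := by
    intro a b hb
    obtain ⟨b, -, rfl⟩ := Finset.mem_image.1 hb
    refine Finset.mem_image.2 ⟨fun y => a ⟨y, hB y.2⟩ ⊔ b y, Finset.mem_univ _, ?_⟩
    ext y : 1
    by_cases hy : (y : ℤ × ℤ) ∈ B
    · simp [ext, g, hy]
    · simp [ext, g, hy, le_one_units]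
  have key := sum_weight_spin_mul_le hβ (γ := γ) (γ' := 1) (fun y => le_one_units _)
    (fun y => φ y) ⟨x, hB hx⟩ _ ht
  rw [Finset.sum_image fun a _ b _ h => hext h, Finset.sum_image fun a _ b _ h => hext h] at key
  -- the weights of a configuration and of its extension are proportional
  obtain ⟨c, hc, hcw⟩ : ∃ c : ℝ, 0 < c ∧ ∀ b : Config B,
      weight Λ β 1 (fun y => φ y) (ext b) = c * weight B β 1 (fun y => φ y) b := by
    let W := (Λ ∪ outerBoundary Λ) ∪ (B ∪ outerBoundary B)
    have e1 : ∀ b, energy Λ 1 (fun y => φ y) (ext b) = -windowEnergy W Λ φ (g b) := by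
      intro b
      rw [← energy_eq_neg_windowEnergy (W := W)
        (fun y hy => by simp [W, hy]) (fun y hy => by simp [W, hy]) φ (g b)]
      congr 1
      ext y : 1
      have : (y : ℤ × ℤ) ∉ B := fun h => (mem_outerBoundary.1 y.2).1 (hB h)
      simp [g, this]
    have e2 : ∀ b, energy B 1 (fun y => φ y) b = -windowEnergy W B φ (g b) := by
      intro b
      rw [← energy_eq_neg_windowEnergy (W := W)
        (fun y hy => by simp [W, hy]) (fun y hy => by simp [W, hy]) φ (g b)]
      congr 1
      · ext y : 1
        have : (y : ℤ × ℤ) ∉ B := (mem_outerBoundary.1 y.2).1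
        simp [g, this]
      · ext y : 1
        simp [g]
    refine ⟨Real.exp (β.toReal * (windowEnergy W Λ φ (g 1) - windowEnergy W B φ (g 1))),
      Real.exp_pos _, fun b => ?_⟩
    rw [weight_of_ne_top hβ, weight_of_ne_top hβ, ← Real.exp_add, e1, e2,
      ← windowEnergy_sub (s := g b) hB φ (fun y hy => by simp [g, hy])]
    congr 1
    ring
  have hval : ∀ b : Config B, ext b ⟨x, hB hx⟩ = b ⟨x, hx⟩ := fun b => by simp [ext, g, hx]
  simp only [hcw, hval, mul_assoc, ← Finset.mul_sum] at key
  rw [meanSpin_eq_div, meanSpin_eq_div, div_le_div_iff₀ (partitionFn_pos _ _ _)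
    (partitionFn_pos _ _ _)]
  simp only [partitionFn] at key ⊢
  refine le_of_mul_le_mul_left ?_ hc
  linarith

lemma energy_neg (γ : BoundaryCondition Λ) (φ : Λ → ℝ) (σ : Config Λ) :
    energy Λ (-γ) (-φ) (-σ) = energy Λ γ φ σ := by
  simp [energy]

lemma meanSpin_neg (hβ : β ≠ ∞) (γ : BoundaryCondition Λ) (φ : Λ → ℝ) (x : Λ) :
    meanSpin Λ β (-γ) (-φ) x = -meanSpin Λ β γ φ x := by
  have hw : ∀ σ, weight Λ β (-γ) (-φ) (-σ) = weight Λ β γ φ σ := fun σ => by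
    rw [weight_of_ne_top hβ, weight_of_ne_top hβ, energy_neg]
  rw [meanSpin_eq_div, meanSpin_eq_div, ← neg_div, ← Finset.sum_neg_distrib, partitionFn,
    partitionFn]
  rw [← Equiv.sum_comp (Equiv.neg (Config Λ)),
    ← Equiv.sum_comp (Equiv.neg (Config Λ)) (fun σ => weight Λ β (-γ) (-φ) σ)]
  simp [hw]

/-- Mean spins decrease when the domain shrinks and the new boundary condition is all minus. -/
theorem minus_le_meanSpin (hβ : β ≠ ∞) {B : Finset (ℤ × ℤ)} (hB : B ⊆ Λ)
    (γ : BoundaryCondition Λ) (φ : ℤ × ℤ → ℝ) {x : ℤ × ℤ} (hx : x ∈ B) :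
    meanSpin B β (-1) (fun y => φ y) ⟨x, hx⟩ ≤ meanSpin Λ β γ (fun y => φ y) ⟨x, hB hx⟩ := by
  have h := meanSpin_le_plus hβ hB (-γ) (-φ) hx
  have h1 := meanSpin_neg hβ γ (fun y => φ y) ⟨x, hB hx⟩
  have h2 := meanSpin_neg hβ (-1 : BoundaryCondition B) (fun y => φ y) ⟨x, hx⟩
  rw [neg_neg] at h2
  have e1 : (fun y : Λ => (-φ) y) = -fun y : Λ => φ y := rfl
  have e2 : (fun y : B => (-φ) y) = -fun y : B => φ y := rfl
  rw [e1, e2, h1, h2] at h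
  linarith

/-! ### The gap between the two extremal boundary conditions -/

/-- The difference of the mean spins at `x` in the domain `B` with all plus and with all minus
boundary conditions; it is `0` by convention if `x ∉ B`. The field is given on the whole lattice,
but only its values on `B` matter. -/
def gap (β : ℝ≥0∞) (B : Finset (ℤ × ℤ)) (φ : ℤ × ℤ → ℝ) (x : ℤ × ℤ) : ℝ :=
  if h : x ∈ B then
    meanSpin B β 1 (fun y => φ y) ⟨x, h⟩ - meanSpin B β (-1) (fun y => φ y) ⟨x, h⟩
  else 0

lemma gap_nonneg (hβ : β ≠ ∞) (B : Finset (ℤ × ℤ)) (φ : ℤ × ℤ → ℝ) (x : ℤ × ℤ) :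
    0 ≤ gap β B φ x := by
  unfold gap
  split_ifs with h
  · exact sub_nonneg.2 (minus_le_meanSpin hβ subset_rfl 1 φ h)
  · exact le_rfl

lemma gap_le_two (β : ℝ≥0∞) (B : Finset (ℤ × ℤ)) (φ : ℤ × ℤ → ℝ) (x : ℤ × ℤ) :
    gap β B φ x ≤ 2 := by
  unfold gap
  split_ifs with h
  · have h1 := (abs_le.1 (abs_meanSpin_le_one (Λ := B) β 1 (fun y => φ y) ⟨x, h⟩)).2
    have h2 := (abs_le.1 (abs_meanSpin_le_one (Λ := B) β (-1) (fun y => φ y) ⟨x, h⟩)).1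
    linarith
  · norm_num

lemma gap_anti (hβ : β ≠ ∞) {B : Finset (ℤ × ℤ)} (hB : B ⊆ Λ) (φ : ℤ × ℤ → ℝ) {x : ℤ × ℤ}
    (hx : x ∈ B) : gap β Λ φ x ≤ gap β B φ x := by
  simp only [gap, hx, hB hx, dif_pos]
  exact sub_le_sub (meanSpin_le_plus hβ hB 1 φ hx) (minus_le_meanSpin hβ hB (-1) φ hx)

lemma gap_congr {B : Finset (ℤ × ℤ)} {φ φ' : ℤ × ℤ → ℝ} (h : ∀ y ∈ B, φ y = φ' y)
    (x : ℤ × ℤ) : gap β B φ x = gap β B φ' x := by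
  have : (fun y : B => φ y) = fun y : B => φ' y := funext fun y => h y y.2
  simp only [gap, this]

lemma boundaryEffect_le_gap (hβ : β ≠ ∞) {B : Finset (ℤ × ℤ)} (hB : B ⊆ Λ) (φ : ℤ × ℤ → ℝ)
    {x : ℤ × ℤ} (hx : x ∈ B) :
    boundaryEffect Λ β (fun y => φ y) ⟨x, hB hx⟩ ≤ gap β B φ x := by
  refine ciSup_le fun p => ?_
  simp only [gap, hx, dif_pos]
  have h1 := meanSpin_le_plus hβ hB p.1 φ hx
  have h2 := meanSpin_le_plus hβ hB p.2 φ hx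
  have h3 := minus_le_meanSpin hβ hB p.1 φ hx
  have h4 := minus_le_meanSpin hβ hB p.2 φ hx
  rw [abs_le]
  constructor <;> linarith

lemma continuous_energy (γ : BoundaryCondition Λ) (σ : Config Λ) :
    Continuous fun φ : Λ → ℝ => energy Λ γ φ σ := by
  unfold energy
  fun_prop

lemma continuous_meanSpin (hβ : β ≠ ∞) (γ : BoundaryCondition Λ) (x : Λ) :
    Continuous fun φ : Λ → ℝ => meanSpin Λ β γ φ x := by
  simp only [meanSpin_eq_div]
  have hw : ∀ σ, Continuous fun φ : Λ → ℝ => weight Λ β γ φ σ := fun σ => by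
    simp only [weight_of_ne_top hβ]
    exact Real.continuous_exp.comp (continuous_const.mul (continuous_energy γ σ))
  refine Continuous.div ?_ (continuous_finsetSum _ fun σ _ => hw σ)
    fun φ => (partitionFn_pos β γ φ).ne'
  exact continuous_finsetSum _ fun σ _ => (hw σ).mul continuous_const

lemma continuous_gap (hβ : β ≠ ∞) (B : Finset (ℤ × ℤ)) (x : ℤ × ℤ) :
    Continuous fun φ : ℤ × ℤ → ℝ => gap β B φ x := by
  by_cases h : x ∈ B
  · simp only [gap, h, dif_pos]
    have hr : Continuous fun φ : ℤ × ℤ → ℝ => fun y : B => φ y := by fun_prop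
    exact ((continuous_meanSpin hβ _ _).comp hr).sub ((continuous_meanSpin hβ _ _).comp hr)
  · simp only [gap, h, dif_neg, not_false_eq_true]
    exact continuous_const

/-- The Ising model is equivariant under automorphisms of the square lattice. -/
lemma meanSpin_image {Λ' : Finset (ℤ × ℤ)} (τ : ℤ × ℤ ≃ ℤ × ℤ)
    (hτ : ∀ x y, τ y ∈ neighbors (τ x) ↔ y ∈ neighbors x) (hΛ : ∀ y, y ∈ Λ ↔ τ y ∈ Λ')
    (u : ℤˣ) (φ : ℤ × ℤ → ℝ) {x : ℤ × ℤ} (hx : x ∈ Λ) :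
    meanSpin Λ' β (fun _ => u) (fun y => φ y) ⟨τ x, (hΛ x).1 hx⟩
      = meanSpin Λ β (fun _ => u) (fun y => φ (τ y)) ⟨x, hx⟩ := by
  have hb : ∀ y, y ∈ outerBoundary Λ ↔ τ y ∈ outerBoundary Λ' := by
    intro y
    simp only [mem_outerBoundary, hΛ]
    refine and_congr_right fun _ => ⟨?_, ?_⟩
    · rintro ⟨z, hz, hyz⟩
      exact ⟨τ z, hz, (hτ _ _).2 hyz⟩
    · rintro ⟨z, hz, hyz⟩
      obtain ⟨z, rfl⟩ := τ.surjective z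
      exact ⟨z, hz, (hτ _ _).1 hyz⟩
  let e : Λ ≃ Λ' := τ.subtypeEquiv hΛ
  let e' : outerBoundary Λ ≃ outerBoundary Λ' := τ.subtypeEquiv hb
  have hE : ∀ σ : Config Λ', energy Λ' (fun _ => u) (fun y => φ y) σ
      = energy Λ (fun _ => u) (fun y => φ (τ y)) (σ ∘ e) := by
    intro σ
    simp only [energy, ← Equiv.sum_comp e, ← Equiv.sum_comp e']
    simp [e, e', hτ]
  let E : Config Λ' ≃ Config Λ := Equiv.arrowCongr e.symm (Equiv.refl _)
  have hE' : ∀ σ, energy Λ' (fun _ => u) (fun y => φ y) σ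
      = energy Λ (fun _ => u) (fun y => φ (τ y)) (E σ) := hE
  have hw : ∀ σ, weight Λ' β (fun _ => u) (fun y => φ y) σ
      = weight Λ β (fun _ => u) (fun y => φ (τ y)) (E σ) := by
    intro σ
    simp only [weight, hE']
    congr 2
    rw [E.forall_congr_left]
    simp
  rw [meanSpin_eq_div, meanSpin_eq_div, partitionFn, partitionFn, ← Equiv.sum_comp E,
    ← Equiv.sum_comp E (fun σ => weight Λ β (fun _ => u) (fun y => φ (τ y)) σ)]
  simp only [hw]
  rfl

/-! ### Boxes -/

/-- The `ℓ^∞` ball of radius `r` around `y`. -/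
def box (y : ℤ × ℤ) (r : ℕ) : Finset (ℤ × ℤ) :=
  Finset.Icc (y.1 - r) (y.1 + r) ×ˢ Finset.Icc (y.2 - r) (y.2 + r)

lemma mem_box {y z : ℤ × ℤ} {r : ℕ} :
    z ∈ box y r ↔ (y.1 - r ≤ z.1 ∧ z.1 ≤ y.1 + r) ∧ y.2 - r ≤ z.2 ∧ z.2 ≤ y.2 + r := by
  simp [box]

lemma self_mem_box (y : ℤ × ℤ) (r : ℕ) : y ∈ box y r := by
  rw [mem_box]; omega

lemma card_box (y : ℤ × ℤ) (r : ℕ) : (box y r).card = (2 * r + 1) ^ 2 := by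
  simp only [box, Finset.card_product, Int.card_Icc]
  rw [pow_two]
  congr 1 <;> omega

lemma box_subset_box {y z : ℤ × ℤ} {r R : ℕ} (hz : z ∈ box y r) (hR : 2 * r ≤ R) :
    box y r ⊆ box z R := by
  intro w hw
  rw [mem_box] at *
  omega

lemma box_mono (y : ℤ × ℤ) {r R : ℕ} (hR : r ≤ R) : box y r ⊆ box y R := by
  intro w hw
  rw [mem_box] at *
  omega

lemma disjoint_box {y z : ℤ × ℤ} {r : ℕ} (h : z ∉ box y (2 * r)) :
    Disjoint (box y r) (box z r) := by
  rw [Finset.disjoint_left]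
  intro w hw hw'
  apply h
  rw [mem_box] at *
  push_cast
  omega

/-- The gap at the center of a box, for the field translated by `y`. -/
lemma gap_box_translate (r : ℕ) (y : ℤ × ℤ) (φ : ℤ × ℤ → ℝ) :
    gap β (box y r) φ y = gap β (box 0 r) (fun z => φ (z + y)) 0 := by
  have hτ : ∀ a b : ℤ × ℤ,
      Equiv.addRight y b ∈ neighbors (Equiv.addRight y a) ↔ b ∈ neighbors a := by
    intro a b
    simp [mem_neighbors]
  have hΛ : ∀ z, z ∈ box 0 r ↔ Equiv.addRight y z ∈ box y r := by
    intro z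
    simp only [mem_box, Equiv.coe_addRight, Prod.fst_add, Prod.snd_add, Prod.fst_zero,
      Prod.snd_zero]
    omega
  have h0 : (Equiv.addRight y) 0 = y := by simp
  simp only [gap, self_mem_box, dif_pos]
  have hu := fun u => meanSpin_image (β := β) (Equiv.addRight y) hτ hΛ u φ (self_mem_box 0 r)
  simp only [h0] at hu
  exact congrArg₂ _ (hu 1) (hu (-1))

/-- A box of radius `L` has `4 (2 L + 1)` boundary edges. -/
lemma sum_boundary_edges_box_le (L : ℕ) (c : ℤ × ℤ) :
    ∑ x : box c L, ∑ y : outerBoundary (box c L),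
      (if (y : ℤ × ℤ) ∈ neighbors x then (1 : ℝ) else 0) ≤ 4 * (2 * L + 1) := by
  set B := box c L with hB
  have h1 : ∀ x ∈ B, ∑ y ∈ outerBoundary B, (if y ∈ neighbors x then (1 : ℝ) else 0)
      ≤ (if x.1 = c.1 + L then 1 else 0) + (if x.1 = c.1 - L then 1 else 0)
        + ((if x.2 = c.2 + L then 1 else 0) + (if x.2 = c.2 - L then 1 else 0)) := by
    intro x hx
    have h2 : ∑ y ∈ outerBoundary B, (if y ∈ neighbors x then (1 : ℝ) else 0)
        ≤ ∑ y ∈ neighbors x, if y ∉ B then (1 : ℝ) else 0 := by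
      rw [← Finset.sum_filter, ← Finset.sum_filter]
      refine Finset.sum_le_sum_of_subset_of_nonneg (fun y hy => ?_) fun _ _ _ => zero_le_one
      rw [Finset.mem_filter] at *
      exact ⟨hy.2, (mem_outerBoundary.1 hy.1).1⟩
    refine h2.trans ?_
    rw [neighbors, Finset.sum_insert (by simp; omega), Finset.sum_insert (by simp),
      Finset.sum_insert (by simp; omega), Finset.sum_singleton, ← add_assoc]
    have hx' := mem_box.1 hx
    have key : ∀ (p : ℤ × ℤ) (q : Prop) [Decidable q], (p ∉ B → q) →
        (if p ∉ B then (1 : ℝ) else 0) ≤ if q then 1 else 0 := by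
      intro p q _ h
      split_ifs with h1 h2 h2
      · norm_num
      · exact le_rfl
      · norm_num
      · exact absurd (h h1) h2
    refine add_le_add (add_le_add (key _ _ ?_) (key _ _ ?_))
      (add_le_add (key _ _ ?_) (key _ _ ?_)) <;>
    · intro h
      rw [hB, mem_box] at h
      dsimp only at h
      omega
  rw [Finset.sum_coe_sort B fun x => ∑ y : outerBoundary B,
    (if (y : ℤ × ℤ) ∈ neighbors x then (1 : ℝ) else 0)]
  have hcard : ∀ a : ℤ, ((Finset.Icc (a - L) (a + L)).card : ℝ) = 2 * L + 1 := by
    intro a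
    have : (Finset.Icc (a - (L : ℤ)) (a + L)).card = 2 * L + 1 := by rw [Int.card_Icc]; omega
    rw [this]; push_cast; ring
  have h3 : ∀ b : ℤ, ∑ x ∈ B, (if x.1 = b then (1 : ℝ) else 0) ≤ 2 * L + 1 := by
    intro b
    rw [hB, box, Finset.sum_product_right]
    simp only [Finset.sum_ite_eq', ← hcard c.2]
    refine (Finset.sum_le_card_nsmul _ _ 1 fun x _ => ?_).trans (by simp)
    split_ifs <;> norm_num
  have h4 : ∀ b : ℤ, ∑ x ∈ B, (if x.2 = b then (1 : ℝ) else 0) ≤ 2 * L + 1 := by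
    intro b
    rw [hB, box, Finset.sum_product]
    simp only [Finset.sum_ite_eq', ← hcard c.1]
    refine (Finset.sum_le_card_nsmul _ _ 1 fun x _ => ?_).trans (by simp)
    split_ifs <;> norm_num
  have h5 := Finset.sum_le_sum h1
  simp only [Finset.sum_add_distrib] at h5
  have h6 : ∑ x ∈ B, ∑ y : outerBoundary B, (if (y : ℤ × ℤ) ∈ neighbors x then (1 : ℝ) else 0)
      = ∑ x ∈ B, ∑ y ∈ outerBoundary B, if y ∈ neighbors x then (1 : ℝ) else 0 :=
    Finset.sum_congr rfl fun x _ => Finset.sum_coe_sort (outerBoundary B) fun y =>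
      if y ∈ neighbors x then (1 : ℝ) else 0
  rw [h6]
  linarith [h3 (c.1 + L), h3 (c.1 - L), h4 (c.2 + L), h4 (c.2 - L)]

/-! ### The free energy along uniform shifts of the field -/

lemma energy_add_const (γ : BoundaryCondition Λ) (φ : Λ → ℝ) (t : ℝ) (σ : Config Λ) :
    energy Λ γ (fun y => φ y + t) σ = energy Λ γ φ σ - t * ∑ x, spin (σ x) := by
  simp only [energy, add_mul, Finset.sum_add_distrib, ← Finset.mul_sum]
  ring

lemma hasDerivAt_log_partitionFn (hβ : β ≠ ∞) (γ : BoundaryCondition Λ) (φ : Λ → ℝ) (t : ℝ) :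
    HasDerivAt (fun t => Real.log (partitionFn Λ β γ fun y => φ y + t))
      (β.toReal * ∑ x, meanSpin Λ β γ (fun y => φ y + t) x) t := by
  have hw : ∀ σ, HasDerivAt (fun t => weight Λ β γ (fun y => φ y + t) σ)
      (β.toReal * (weight Λ β γ (fun y => φ y + t) σ * ∑ x, spin (σ x))) t := by
    intro σ
    simp only [weight_of_ne_top hβ, energy_add_const]
    have h := (((hasDerivAt_id t).mul_const (∑ x, spin (σ x))).const_sub
      (energy Λ γ φ σ)).const_mul (-β.toReal)
    refine h.exp.congr_deriv ?_
    simp only [id]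
    ring
  have hZ : HasDerivAt (fun t => partitionFn Λ β γ fun y => φ y + t)
      (∑ σ, β.toReal * (weight Λ β γ (fun y => φ y + t) σ * ∑ x, spin (σ x))) t := by
    simp only [partitionFn]
    exact HasDerivAt.fun_sum fun σ _ => hw σ
  refine (hZ.log (partitionFn_pos _ _ _).ne').congr_deriv ?_
  simp only [meanSpin_eq_div, ← Finset.sum_div, ← Finset.mul_sum]
  rw [Finset.sum_comm, mul_div_assoc]
  simp only [Finset.mul_sum]

/-- The free energies for two boundary conditions differ at most by twice the number `b` of
boundary edges. -/
lemma log_partitionFn_le (hβ : β ≠ ∞) (γ γ' : BoundaryCondition Λ) (φ : Λ → ℝ) {b : ℝ}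
    (hb : ∑ x : Λ, ∑ y : outerBoundary Λ,
      (if (y : ℤ × ℤ) ∈ neighbors x then (1 : ℝ) else 0) ≤ b) :
    Real.log (partitionFn Λ β γ φ) ≤ Real.log (partitionFn Λ β γ' φ) + β.toReal * (2 * b) := by
  have hE : ∀ σ, energy Λ γ' φ σ ≤ energy Λ γ φ σ + 2 * b := by
    intro σ
    have h : (∑ x : Λ, ∑ y : outerBoundary Λ,
          if (y : ℤ × ℤ) ∈ neighbors x then spin (σ x) * spin (γ y) else 0)
        ≤ (∑ x : Λ, ∑ y : outerBoundary Λ,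
          if (y : ℤ × ℤ) ∈ neighbors x then spin (σ x) * spin (γ' y) else 0)
        + 2 * ∑ x : Λ, ∑ y : outerBoundary Λ,
          if (y : ℤ × ℤ) ∈ neighbors x then (1 : ℝ) else 0 := by
      simp only [Finset.mul_sum, ← Finset.sum_add_distrib]
      refine Finset.sum_le_sum fun x _ => Finset.sum_le_sum fun y _ => ?_
      split_ifs
      · have h1 : ∀ u : ℤˣ, |spin (σ x) * spin u| = 1 := fun u => by
          rw [abs_mul, abs_spin, abs_spin, one_mul]
        have h2 := (abs_le.1 (h1 (γ y)).le).2
        have h3 := (abs_le.1 (h1 (γ' y)).le).1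
        linarith
      · simp
    simp only [energy]
    linarith
  have hZ : partitionFn Λ β γ φ ≤ partitionFn Λ β γ' φ * Real.exp (β.toReal * (2 * b)) := by
    simp only [partitionFn, Finset.sum_mul]
    refine Finset.sum_le_sum fun σ _ => ?_
    rw [weight_of_ne_top hβ, weight_of_ne_top hβ, ← Real.exp_add]
    refine Real.exp_le_exp.2 ?_
    have := mul_le_mul_of_nonneg_left (hE σ) (ENNReal.toReal_nonneg (a := β))
    linarith
  have := Real.log_le_log (partitionFn_pos _ _ _) hZ
  rwa [Real.log_mul (partitionFn_pos _ _ _).ne' (Real.exp_ne_zero _), Real.log_exp] at this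

lemma meanSpin_zero (γ γ' : BoundaryCondition Λ) (φ : Λ → ℝ) (x : Λ) :
    meanSpin Λ 0 γ φ x = meanSpin Λ 0 γ' φ x := by
  simp [meanSpin, isingProb, weight]

/-- The total gap, integrated along uniform shifts of the field, is at most four times the number
`b` of boundary edges: it is the derivative of the difference of the free energies. -/
lemma integral_sum_meanSpin_sub_le (hβ : β ≠ ∞) (φ : Λ → ℝ) {b : ℝ}
    (hb : ∑ x : Λ, ∑ y : outerBoundary Λ,
      (if (y : ℤ × ℤ) ∈ neighbors x then (1 : ℝ) else 0) ≤ b) (T : ℝ) :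
    ∫ t in (-T)..T, ∑ x, (meanSpin Λ β 1 (fun y => φ y + t) x
      - meanSpin Λ β (-1) (fun y => φ y + t) x) ≤ 4 * b := by
  rcases eq_or_ne β 0 with rfl | hβ0
  · have : 0 ≤ b := le_trans (Finset.sum_nonneg fun x _ => Finset.sum_nonneg fun y _ => by
      split_ifs <;> norm_num) hb
    simp only [meanSpin_zero 1 (-1), sub_self, Finset.sum_const_zero,
      intervalIntegral.integral_zero]
    linarith
  have hpos : 0 < β.toReal := ENNReal.toReal_pos hβ0 hβ
  have hcont : Continuous fun t : ℝ => ∑ x, (meanSpin Λ β 1 (fun y => φ y + t) x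
      - meanSpin Λ β (-1) (fun y => φ y + t) x) := by
    have hr : Continuous fun t : ℝ => fun y : Λ => φ y + t := by fun_prop
    exact continuous_finsetSum _ fun x _ =>
      ((continuous_meanSpin hβ _ _).comp hr).sub ((continuous_meanSpin hβ _ _).comp hr)
  have hint := intervalIntegral.integral_eq_sub_of_hasDerivAt (a := -T) (b := T)
    (f := fun t => Real.log (partitionFn Λ β 1 fun y => φ y + t)
      - Real.log (partitionFn Λ β (-1) fun y => φ y + t))
    (f' := fun t => β.toReal * ∑ x, (meanSpin Λ β 1 (fun y => φ y + t) x
      - meanSpin Λ β (-1) (fun y => φ y + t) x))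
    (fun t _ => ((hasDerivAt_log_partitionFn hβ 1 φ t).sub
      (hasDerivAt_log_partitionFn hβ (-1) φ t)).congr_deriv (by
        rw [Finset.sum_sub_distrib, mul_sub]))
    ((continuous_const.mul hcont).intervalIntegrable _ _)
  rw [intervalIntegral.integral_const_mul] at hint
  have h1 := log_partitionFn_le hβ 1 (-1) (fun y => φ y + T) hb
  have h2 := log_partitionFn_le hβ (-1) 1 (fun y => φ y + -T) hb
  refine le_of_mul_le_mul_left ?_ hpos
  rw [hint]
  linarith

/-! ### Uniform shifts of Gaussian vectors -/

section Shift

variable {ι : Type*} [Fintype ι]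

lemma lintegral_pi_prod_eq (ν : ι → Measure ℝ) [∀ i, IsProbabilityMeasure (ν i)]
    {f : ι → ℝ → ℝ≥0∞} (hf : ∀ i, Measurable (f i)) :
    ∫⁻ x, ∏ i, f i (x i) ∂Measure.pi ν = ∏ i, ∫⁻ x, f i x ∂ν i := by
  have h : iIndepFun (fun i (x : ι → ℝ) => f i (x i)) (Measure.pi ν) :=
    iIndepFun_pi fun i => (hf i).aemeasurable
  rw [lintegral_prod_eq_prod_lintegral_of_indepFun Finset.univ _ h
    fun i => (hf i).comp (measurable_pi_apply i)]
  exact Finset.prod_congr rfl fun i _ => (measurePreserving_eval ν i).lintegral_comp (hf i)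

lemma pi_withDensity (ν : ι → Measure ℝ) [∀ i, IsProbabilityMeasure (ν i)]
    {f : ι → ℝ → ℝ≥0∞} (hf : ∀ i, Measurable (f i))
    [∀ i, SigmaFinite ((ν i).withDensity (f i))] :
    Measure.pi (fun i => (ν i).withDensity (f i))
      = (Measure.pi ν).withDensity fun x => ∏ i, f i (x i) := by
  refine Measure.pi_eq fun s hs => ?_
  rw [withDensity_apply _ (MeasurableSet.univ_pi hs),
    ← lintegral_indicator (MeasurableSet.univ_pi hs)]
  have h : (Set.univ.pi s).indicator (fun x : ι → ℝ => ∏ i, f i (x i))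
      = fun x => ∏ i, (s i).indicator (f i) (x i) := by
    ext x
    by_cases hx : x ∈ Set.univ.pi s
    · rw [Set.indicator_of_mem hx]
      exact Finset.prod_congr rfl fun i _ => by
        rw [Set.indicator_of_mem (hx i (Set.mem_univ i))]
    · rw [Set.indicator_of_notMem hx]
      simp only [Set.mem_univ_pi, not_forall] at hx
      obtain ⟨i, hi⟩ := hx
      exact (Finset.prod_eq_zero (Finset.mem_univ i) (Set.indicator_of_notMem hi _)).symm
  rw [h, lintegral_pi_prod_eq ν fun i => (hf i).indicator (hs i)]
  exact Finset.prod_congr rfl fun i _ => by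
    rw [lintegral_indicator (hs i), withDensity_apply _ (hs i)]

lemma gaussianReal_eq_withDensity {v : ℝ≥0} (hv : v ≠ 0) (t : ℝ) :
    gaussianReal t v = (gaussianReal 0 v).withDensity
      fun x => ENNReal.ofReal (Real.exp (t * x / v - t ^ 2 / (2 * v))) := by
  rw [gaussianReal_of_var_ne_zero t hv, gaussianReal_of_var_ne_zero 0 hv,
    ← withDensity_mul _ (by fun_prop) (by fun_prop)]
  congr 1
  ext x
  have hv' : (v : ℝ) ≠ 0 := by exact_mod_cast hv
  rw [Pi.mul_apply, gaussianPDF, gaussianPDF, ← ENNReal.ofReal_mul (gaussianPDFReal_nonneg _ _ _)]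
  simp only [gaussianPDFReal, mul_assoc, ← Real.exp_add]
  congr 3
  field_simp
  ring

lemma lintegral_sq_density {v : ℝ≥0} (hv : v ≠ 0) (t : ℝ) :
    ∫⁻ x, ENNReal.ofReal (Real.exp (t * x / v - t ^ 2 / (2 * v))) ^ 2 ∂gaussianReal 0 v
      = ENNReal.ofReal (Real.exp (t ^ 2 / v)) := by
  have hv' : (v : ℝ) ≠ 0 := by exact_mod_cast hv
  have h1 : ∀ x : ℝ, ENNReal.ofReal (Real.exp (t * x / v - t ^ 2 / (2 * v))) ^ 2
      = ENNReal.ofReal (Real.exp (-(t ^ 2 / v)) * Real.exp (2 * t / v * x)) := by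
    intro x
    rw [← ENNReal.ofReal_pow (Real.exp_nonneg _), ← Real.exp_nat_mul, ← Real.exp_add]
    congr 2
    push_cast
    field_simp
    ring
  have hi : Integrable (fun x : ℝ => Real.exp (2 * t / v * x)) (gaussianReal 0 v) :=
    integrable_exp_mul_gaussianReal _
  simp only [h1]
  rw [← ofReal_integral_eq_lintegral_ofReal (hi.const_mul _)
    (Filter.Eventually.of_forall fun x => by positivity), integral_const_mul]
  have h2 := congrFun (mgf_fun_id_gaussianReal (μ := 0) (v := v)) (2 * t / v)
  simp only [mgf] at h2
  rw [h2, ← Real.exp_add]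
  congr 2
  field_simp
  ring

/-- A quantitative form of the absolute continuity of the shifted Gaussian law: the second moment
of the Cameron–Martin density controls how much mass a shift can bring into an event. -/
lemma pi_gaussian_shift_le {v : ℝ≥0} (hv : v ≠ 0) (t : ℝ) {A : Set (ι → ℝ)}
    (hA : MeasurableSet A) :
    (Measure.pi fun _ : ι => gaussianReal 0 v) ((fun φ i => φ i + t) ⁻¹' A)
      ≤ ENNReal.ofReal (Real.exp (t ^ 2 * Fintype.card ι / v))
        * (Measure.pi fun _ : ι => gaussianReal 0 v) A + ENNReal.ofReal (1 / 4) := by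
  set ν : Measure (ι → ℝ) := Measure.pi fun _ : ι => gaussianReal 0 v with hν
  set E : ℝ := Real.exp (t ^ 2 * Fintype.card ι / v) with hE
  have hEpos : 0 < E := Real.exp_pos _
  let f : ℝ → ℝ≥0∞ := fun x => ENNReal.ofReal (Real.exp (t * x / v - t ^ 2 / (2 * v)))
  have hf : Measurable f := by fun_prop
  have hmap : ν.map (fun φ i => φ i + t) = ν.withDensity fun x => ∏ i, f (x i) := by
    have hs : gaussianReal t v = (gaussianReal 0 v).withDensity f :=
      gaussianReal_eq_withDensity hv t
    have : IsProbabilityMeasure ((gaussianReal 0 v).withDensity f) := hs ▸ inferInstance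
    have : IsProbabilityMeasure ((gaussianReal 0 v).map fun x => x + t) :=
      Measure.isProbabilityMeasure_map (by fun_prop)
    rw [hν, Measure.pi_map_pi (f := fun _ x => x + t) fun i => by fun_prop]
    rw [← pi_withDensity (fun _ => gaussianReal 0 v) fun _ => hf]
    congr 1
    ext1 i
    rw [gaussianReal_map_add_const, zero_add, hs]
  have hsq : ∫⁻ x, (∏ i, f (x i)) ^ 2 ∂ν = ENNReal.ofReal E := by
    simp only [← Finset.prod_pow]
    rw [hν, lintegral_pi_prod_eq (fun _ => gaussianReal 0 v) (f := fun _ x => f x ^ 2)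
      fun _ => hf.pow_const 2]
    simp only [f, lintegral_sq_density hv, Finset.prod_const]
    rw [← ENNReal.ofReal_pow (Real.exp_nonneg _), ← Real.exp_nat_mul, hE, Finset.card_univ]
    congr 2
    ring
  have hle : ∀ x : ι → ℝ, ∏ i, f (x i)
      ≤ ENNReal.ofReal E + ENNReal.ofReal (1 / (4 * E)) * (∏ i, f (x i)) ^ 2 := by
    intro x
    simp only [f]
    rw [← ENNReal.ofReal_prod_of_nonneg fun i _ => Real.exp_nonneg _]
    set G := ∏ i, Real.exp (t * x i / v - t ^ 2 / (2 * v))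
    have hG : 0 ≤ G := Finset.prod_nonneg fun i _ => Real.exp_nonneg _
    rw [← ENNReal.ofReal_pow hG, ← ENNReal.ofReal_mul (by positivity),
      ← ENNReal.ofReal_add hEpos.le (by positivity)]
    refine ENNReal.ofReal_le_ofReal ?_
    have h : E + 1 / (4 * E) * G ^ 2 - G = (2 * E - G) ^ 2 / (4 * E) := by field_simp; ring
    have : 0 ≤ (2 * E - G) ^ 2 / (4 * E) := by positivity
    linarith
  rw [← Measure.map_apply (by fun_prop) hA, hmap, withDensity_apply _ hA]
  calc ∫⁻ x in A, ∏ i, f (x i) ∂ν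
      ≤ ∫⁻ x in A, (ENNReal.ofReal E
          + ENNReal.ofReal (1 / (4 * E)) * (∏ i, f (x i)) ^ 2) ∂ν := lintegral_mono hle
    _ = ENNReal.ofReal E * ν A
          + ENNReal.ofReal (1 / (4 * E)) * ∫⁻ x in A, (∏ i, f (x i)) ^ 2 ∂ν := by
        rw [lintegral_add_left measurable_const, setLIntegral_const,
          lintegral_const_mul _ (by fun_prop)]
    _ ≤ ENNReal.ofReal E * ν A + ENNReal.ofReal (1 / (4 * E)) * ENNReal.ofReal E := by
        gcongr
        exact (setLIntegral_le_lintegral _ _).trans hsq.le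
    _ = _ := by
        rw [← ENNReal.ofReal_mul (by positivity)]
        congr 2
        field_simp

/-- If a nonnegative observable is at least `δ` outside an event so rare that shifts up to `T`
cannot make it likely, then its integral along shifts in `[-T, T]` cannot be below `T δ`. -/
lemma mul_le_of_integral_shift_le {v : ℝ≥0} (hv : v ≠ 0) {g : (ι → ℝ) → ℝ} (hg : Continuous g)
    (hg0 : ∀ φ, 0 ≤ g φ) {T δ K : ℝ} (hT : 0 ≤ T) (hδ : 0 ≤ δ)
    (hK : ∀ φ : ι → ℝ, ∫ t in (-T)..T, g (fun i => φ i + t) ≤ K)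
    (hA : (Measure.pi fun _ : ι => gaussianReal 0 v).real {φ | g φ < δ}
      ≤ Real.exp (-(T ^ 2 * Fintype.card ι / v)) / 4) :
    T * δ ≤ K := by
  set ν : Measure (ι → ℝ) := Measure.pi fun _ : ι => gaussianReal 0 v with hν
  have hAm : MeasurableSet {φ | g φ < δ} := measurableSet_lt hg.measurable measurable_const
  have hK0 : 0 ≤ K := le_trans
    (intervalIntegral.integral_nonneg (by linarith) fun t _ => hg0 _) (hK 0)
  -- each shift in `[-T, T]` keeps the observable above `δ` with probability at least `1 / 2`
  have hprob : ∀ t ∈ Set.Ioc (-T) T,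
      ENNReal.ofReal (δ / 2) ≤ ∫⁻ φ, ENNReal.ofReal (g fun i => φ i + t) ∂ν := by
    intro t ht
    have h1 := pi_gaussian_shift_le (ι := ι) hv t hAm
    have h2 : ν ((fun φ i => φ i + t) ⁻¹' {φ | g φ < δ}) ≤ ENNReal.ofReal (1 / 2) := by
      refine h1.trans ?_
      rw [← hν, ← ofReal_measureReal, ← ENNReal.ofReal_mul (Real.exp_nonneg _),
        ← ENNReal.ofReal_add (by positivity) (by norm_num)]
      refine ENNReal.ofReal_le_ofReal ?_
      have ht2 : t ^ 2 ≤ T ^ 2 := sq_le_sq' ht.1.le ht.2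
      have h3 : Real.exp (t ^ 2 * Fintype.card ι / v) ≤ Real.exp (T ^ 2 * Fintype.card ι / v) :=
        Real.exp_le_exp.2 (by gcongr)
      have h4 := mul_le_mul h3 hA measureReal_nonneg (Real.exp_nonneg _)
      rw [Real.exp_neg, ← mul_div_assoc, mul_inv_cancel₀ (Real.exp_ne_zero _)] at h4
      linarith
    have hm : MeasurableSet {φ : ι → ℝ | δ ≤ g fun i => φ i + t} :=
      measurableSet_le measurable_const (hg.comp (by fun_prop)).measurable
    have h5 : ENNReal.ofReal (1 / 2) ≤ ν {φ | δ ≤ g fun i => φ i + t} := by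
      have hc : {φ : ι → ℝ | δ ≤ g fun i => φ i + t}ᶜ
          = (fun φ i => φ i + t) ⁻¹' {φ | g φ < δ} := by
        ext φ; simp
      have h6 := prob_add_prob_compl (μ := ν) hm
      rw [hc] at h6
      have h7 : (1 : ℝ≥0∞) ≤ ν {φ | δ ≤ g fun i => φ i + t} + ENNReal.ofReal (1 / 2) := by
        rw [← h6]; gcongr
      have h8 : (1 : ℝ≥0∞) = ENNReal.ofReal (1 / 2) + ENNReal.ofReal (1 / 2) := by
        rw [← ENNReal.ofReal_add (by norm_num) (by norm_num)]; norm_num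
      rw [h8] at h7
      exact (ENNReal.add_le_add_iff_right ENNReal.ofReal_ne_top).1 h7
    calc ENNReal.ofReal (δ / 2) = ENNReal.ofReal δ * ENNReal.ofReal (1 / 2) := by
          rw [← ENNReal.ofReal_mul hδ]; ring_nf
      _ ≤ ENNReal.ofReal δ * ν {φ | δ ≤ g fun i => φ i + t} := by gcongr
      _ ≤ ENNReal.ofReal δ * ν {φ | ENNReal.ofReal δ ≤ ENNReal.ofReal (g fun i => φ i + t)} := by
          gcongr with φ
          exact ENNReal.ofReal_le_ofReal
      _ ≤ _ := mul_meas_ge_le_lintegral₀ (by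
          exact ((hg.comp (by fun_prop)).measurable.ennreal_ofReal).aemeasurable) _
  have hswap := lintegral_lintegral_swap (μ := ν) (ν := volume.restrict (Set.Ioc (-T) T))
    (f := fun φ t => ENNReal.ofReal (g fun i => φ i + t)) (by
      refine Measurable.aemeasurable ?_
      exact (hg.comp (by fun_prop : Continuous fun p : (ι → ℝ) × ℝ => fun i => p.1 i + p.2)
        ).measurable.ennreal_ofReal)
  have hup : ∫⁻ φ, (∫⁻ t in Set.Ioc (-T) T, ENNReal.ofReal (g fun i => φ i + t)) ∂ν
      ≤ ENNReal.ofReal K := by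
    have : ∀ φ : ι → ℝ, ∫⁻ t in Set.Ioc (-T) T, ENNReal.ofReal (g fun i => φ i + t)
        ≤ ENNReal.ofReal K := by
      intro φ
      have hc : Continuous fun t : ℝ => g fun i => φ i + t := hg.comp (by fun_prop)
      rw [← ofReal_integral_eq_lintegral_ofReal
        (hc.integrableOn_Ioc) (Filter.Eventually.of_forall fun t => hg0 _),
        ← intervalIntegral.integral_of_le (by linarith)]
      exact ENNReal.ofReal_le_ofReal (hK φ)
    refine (lintegral_mono this).trans ?_
    simp
  have hlow : ENNReal.ofReal (T * δ)
      ≤ ∫⁻ t in Set.Ioc (-T) T, ∫⁻ φ, ENNReal.ofReal (g fun i => φ i + t) ∂ν := by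
    calc ENNReal.ofReal (T * δ) = ∫⁻ _ in Set.Ioc (-T) T, ENNReal.ofReal (δ / 2) := by
          rw [setLIntegral_const, Real.volume_Ioc, ← ENNReal.ofReal_mul (by positivity)]
          congr 1; ring
      _ ≤ _ := setLIntegral_mono' measurableSet_Ioc hprob
  exact (ENNReal.ofReal_le_ofReal_iff hK0).1 (hlow.trans (hswap ▸ hup))

end Shift

/-! ### The random field on the whole lattice -/

variable {v : ℝ≥0}

/-- The law of a field of independent centered Gaussians of variance `v` on `ℤ²`. -/
def fieldLaw (v : ℝ≥0) : Measure (ℤ × ℤ → ℝ) := Measure.infinitePi fun _ => gaussianReal 0 v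

instance (v : ℝ≥0) : IsProbabilityMeasure (fieldLaw v) := by
  unfold fieldLaw; infer_instance

/-- The expected gap at the center of a box of radius `r`. -/
def meanGap (β : ℝ≥0∞) (v : ℝ≥0) (r : ℕ) : ℝ := ∫ φ, gap β (box 0 r) φ 0 ∂fieldLaw v

lemma measurePreserving_translate (v : ℝ≥0) (y : ℤ × ℤ) :
    MeasurePreserving (fun (φ : ℤ × ℤ → ℝ) z => φ (z + y)) (fieldLaw v) (fieldLaw v) := by
  refine ⟨by fun_prop, ?_⟩
  have h := Measure.infinitePi_map_piCongrLeft (X := fun _ : ℤ × ℤ => ℝ)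
    (fun _ : ℤ × ℤ => gaussianReal 0 v) (Equiv.addRight (-y))
  rw [fieldLaw]
  convert h using 2
  ext φ z
  have h1 := Equiv.piCongrLeft_apply_apply (P := fun _ : ℤ × ℤ => ℝ) (Equiv.addRight (-y)) φ (z + y)
  simp only [Equiv.coe_addRight, add_neg_cancel_right] at h1
  exact h1.symm

lemma integrable_gap (hβ : β ≠ ∞) (B : Finset (ℤ × ℤ)) (x : ℤ × ℤ) :
    Integrable (fun φ => gap β B φ x) (fieldLaw v) := by
  refine Integrable.of_bound (continuous_gap hβ B x).measurable.aestronglyMeasurable 2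
    (Filter.Eventually.of_forall fun φ => ?_)
  rw [Real.norm_eq_abs, abs_of_nonneg (gap_nonneg hβ _ _ _)]
  exact gap_le_two _ _ _ _

lemma integral_gap_box (hβ : β ≠ ∞) (r : ℕ) (y : ℤ × ℤ) :
    ∫ φ, gap β (box y r) φ y ∂fieldLaw v = meanGap β v r := by
  have hτ := measurePreserving_translate v y
  have h := integral_map (μ := fieldLaw v) hτ.measurable.aemeasurable
    (f := fun φ => gap β (box 0 r) φ 0) (continuous_gap hβ _ _).measurable.aestronglyMeasurable
  rw [hτ.map_eq] at h
  simp only [gap_box_translate r y]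
  exact h.symm

lemma meanGap_nonneg (hβ : β ≠ ∞) (r : ℕ) : 0 ≤ meanGap β v r :=
  integral_nonneg fun _ => gap_nonneg hβ _ _ _

lemma meanGap_le_two (hβ : β ≠ ∞) (r : ℕ) : meanGap β v r ≤ 2 := by
  refine (integral_mono (integrable_gap hβ _ _) (integrable_const 2)
    fun φ => gap_le_two _ _ _ _).trans ?_
  simp

lemma meanGap_anti (hβ : β ≠ ∞) : Antitone (meanGap β v) := fun _ _ h =>
  integral_mono (integrable_gap hβ _ _) (integrable_gap hβ _ _)
    fun φ => gap_anti hβ (box_mono 0 h) φ (self_mem_box 0 _)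

lemma indepFun_gap (hβ : β ≠ ∞) {B B' : Finset (ℤ × ℤ)} (h : Disjoint B B') (x x' : ℤ × ℤ) :
    IndepFun (fun φ => gap β B φ x) (fun φ => gap β B' φ x') (fieldLaw v) := by
  have hi : iIndepFun (fun (z : ℤ × ℤ) (φ : ℤ × ℤ → ℝ) => φ z) (fieldLaw v) :=
    iIndepFun_infinitePi (X := fun _ ω => ω) (by fun_prop)
  have hc := hi.indepFun_finset B B' h fun z => by fun_prop
  let e : ∀ C : Finset (ℤ × ℤ), (C → ℝ) → ℤ × ℤ → ℝ := fun C ψ y =>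
    if h : y ∈ C then ψ ⟨y, h⟩ else 0
  have he : ∀ C, Continuous (e C) := fun C => continuous_pi fun y => by
    by_cases h : y ∈ C
    · simp only [e, h, dif_pos]; fun_prop
    · simp only [e, h, dif_neg, not_false_eq_true]; fun_prop
  have hF : ∀ C z, Measurable fun ψ => gap β C (e C ψ) z := fun C z =>
    ((continuous_gap hβ C z).comp (he C)).measurable
  have hg : ∀ C z, (fun φ => gap β C φ z)
      = (fun ψ => gap β C (e C ψ) z) ∘ fun φ (y : C) => φ y := fun C z =>
    funext fun φ => gap_congr (fun y hy => by simp [e, hy]) z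
  rw [hg B x, hg B' x']
  exact hc.comp (hF B x) (hF B' x')

/-! ### Spatial averages of the gap -/

lemma abs_mul_centered_gap_le (hβ : β ≠ ∞) (r : ℕ) (y z : ℤ × ℤ) (φ : ℤ × ℤ → ℝ) :
    |(gap β (box y r) φ y - meanGap β v r) * (gap β (box z r) φ z - meanGap β v r)| ≤ 4 := by
  have hb : ∀ w, |gap β (box w r) φ w - meanGap β v r| ≤ 2 := fun w => by
    rw [abs_le]
    constructor <;> linarith [gap_nonneg hβ (box w r) φ w, gap_le_two β (box w r) φ w,
      meanGap_nonneg (v := v) hβ r, meanGap_le_two (v := v) hβ r]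
  rw [abs_mul]
  nlinarith [hb y, hb z, abs_nonneg (gap β (box y r) φ y - meanGap β v r),
    abs_nonneg (gap β (box z r) φ z - meanGap β v r)]

lemma integrable_mul_centered_gap (hβ : β ≠ ∞) (r : ℕ) (y z : ℤ × ℤ) :
    Integrable (fun φ => (gap β (box y r) φ y - meanGap β v r)
      * (gap β (box z r) φ z - meanGap β v r)) (fieldLaw v) :=
  Integrable.of_bound (((continuous_gap hβ _ _).measurable.sub_const _).mul
    ((continuous_gap hβ _ _).measurable.sub_const _)).aestronglyMeasurable 4
    (Filter.Eventually.of_forall fun φ => abs_mul_centered_gap_le hβ r y z φ)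

/-- The centered gaps in boxes of radius `r` have bounded covariances, which vanish at distance
more than `2 r`. -/
lemma integral_mul_centered_gap_le (hβ : β ≠ ∞) (r : ℕ) (y z : ℤ × ℤ) :
    ∫ φ, (gap β (box y r) φ y - meanGap β v r) * (gap β (box z r) φ z - meanGap β v r) ∂fieldLaw v
      ≤ if z ∈ box y (2 * r) then 4 else 0 := by
  split_ifs with h
  · refine (integral_mono (integrable_mul_centered_gap hβ r y z) (integrable_const 4) fun φ =>
      (le_abs_self _).trans (abs_mul_centered_gap_le hβ r y z φ)).trans ?_
    simp
  · have hc : ∀ w, Measurable fun φ => gap β (box w r) φ w - meanGap β v r := fun w =>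
      (continuous_gap hβ _ _).measurable.sub_const _
    have hi := (indepFun_gap (v := v) hβ (disjoint_box h) y z).comp
      (measurable_id.sub_const (meanGap β v r)) (measurable_id.sub_const (meanGap β v r))
    have h0 := hi.integral_mul_eq_mul_integral (hc y).aestronglyMeasurable
      (hc z).aestronglyMeasurable
    refine le_of_eq (h0.trans ?_)
    have : ∫ φ, (gap β (box y r) φ y - meanGap β v r) ∂fieldLaw v = 0 := by
      rw [integral_sub (integrable_gap hβ _ _) (integrable_const _), integral_gap_box hβ]
      simp
    exact mul_eq_zero_of_left this _

lemma integral_sq_average_sub_le (hβ : β ≠ ∞) (r : ℕ) {Q : Finset (ℤ × ℤ)} (hQ : Q.Nonempty) :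
    ∫ φ, ((∑ y ∈ Q, gap β (box y r) φ y) / Q.card - meanGap β v r) ^ 2 ∂fieldLaw v
      ≤ 4 * (4 * r + 1) ^ 2 / Q.card := by
  have hN : (0 : ℝ) < Q.card := by exact_mod_cast hQ.card_pos
  have hint := integrable_mul_centered_gap (v := v) hβ r
  have h1 : ∀ φ, ((∑ y ∈ Q, gap β (box y r) φ y) / Q.card - meanGap β v r) ^ 2
      = (∑ y ∈ Q, ∑ z ∈ Q, (gap β (box y r) φ y - meanGap β v r)
        * (gap β (box z r) φ z - meanGap β v r)) / (Q.card : ℝ) ^ 2 := by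
    intro φ
    rw [← Finset.sum_mul_sum, Finset.sum_sub_distrib, Finset.sum_const, nsmul_eq_mul]
    field_simp
  simp only [h1]
  rw [integral_div, integral_finsetSum _ fun y _ => integrable_finsetSum _ fun z _ => hint y z,
    div_le_div_iff₀ (by positivity) hN]
  have h2 : ∀ y ∈ Q, ∫ φ, ∑ z ∈ Q, (gap β (box y r) φ y - meanGap β v r)
      * (gap β (box z r) φ z - meanGap β v r) ∂fieldLaw v ≤ 4 * (4 * r + 1) ^ 2 := by
    intro y _
    rw [integral_finsetSum _ fun z _ => hint y z]
    refine (Finset.sum_le_sum fun z _ => integral_mul_centered_gap_le hβ r y z).trans ?_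
    rw [Finset.sum_ite_mem, Finset.sum_const, nsmul_eq_mul, mul_comm]
    have h3 : (Q ∩ box y (2 * r)).card ≤ (2 * (2 * r) + 1) ^ 2 :=
      (Finset.card_le_card Finset.inter_subset_right).trans (card_box _ _).le
    have h4 : ((Q ∩ box y (2 * r)).card : ℝ) ≤ (2 * (2 * r) + 1) ^ 2 := by exact_mod_cast h3
    nlinarith
  have h5 := Finset.sum_le_card_nsmul Q _ _ h2
  rw [nsmul_eq_mul] at h5
  calc _ ≤ (Q.card * (4 * (4 * r + 1) ^ 2) : ℝ) * Q.card := by gcongr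
    _ = _ := by ring

/-- If the mean gaps at the scales `r` and `2 L` are close and `r` is much smaller than `L`, the
average of the gaps in `box 0 L` is rarely far below the mean gap: it dominates the average of the
gaps at scale `2 L`, which is close in mean to the one at scale `r`, which concentrates. -/
lemma measure_average_gap_lt_le (hβ : β ≠ ∞) {r L : ℕ} (hrL : r ≤ 2 * L) {δ : ℝ} (hδ : 0 < δ)
    (hδr : δ ≤ meanGap β v r) :
    (fieldLaw v).real
        {φ | (∑ y ∈ box 0 L, gap β (box 0 L) φ y) / (box 0 L).card < δ / 2}
      ≤ 16 / δ ^ 2 * (4 * (4 * r + 1) ^ 2 / (2 * L + 1) ^ 2)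
        + 4 / δ * (meanGap β v r - meanGap β v (2 * L)) := by
  set Q := box 0 L with hQ
  have hcard : (Q.card : ℝ) = (2 * L + 1) ^ 2 := by rw [hQ, card_box]; push_cast; ring
  have hN : (0 : ℝ) < Q.card := by rw [hcard]; positivity
  have hQne : Q.Nonempty := ⟨0, self_mem_box 0 L⟩
  let X : ℕ → (ℤ × ℤ → ℝ) → ℝ := fun k φ => (∑ y ∈ Q, gap β (box y k) φ y) / Q.card
  have hXi : ∀ k, Integrable (X k) (fieldLaw v) := fun k =>
    (integrable_finsetSum _ fun y _ => integrable_gap hβ _ _).div_const _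
  have hXm : ∀ k, ∫ φ, X k φ ∂fieldLaw v = meanGap β v k := fun k => by
    simp only [X]
    rw [integral_div, integral_finsetSum _ fun y _ => integrable_gap hβ _ _]
    simp only [integral_gap_box hβ, Finset.sum_const, nsmul_eq_mul]
    field_simp
  have hXc : ∀ k, Continuous (X k) := fun k =>
    (continuous_finsetSum _ fun y _ => continuous_gap hβ _ _).div_const _
  have hX2 : ∀ φ, X (2 * L) φ ≤ (∑ y ∈ Q, gap β Q φ y) / Q.card := fun φ => by
    refine div_le_div_of_nonneg_right (Finset.sum_le_sum fun y hy => ?_) hN.le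
    exact gap_anti hβ (box_subset_box hy le_rfl) φ hy
  have hXr : ∀ φ, X (2 * L) φ ≤ X r φ := fun φ => by
    refine div_le_div_of_nonneg_right (Finset.sum_le_sum fun y _ => ?_) hN.le
    exact gap_anti hβ (box_mono y hrL) φ (self_mem_box y r)
  have hb : ∀ φ, |X r φ - meanGap β v r| ≤ 2 := fun φ => by
    have h0 : 0 ≤ X r φ := div_nonneg (Finset.sum_nonneg fun y _ => gap_nonneg hβ _ _ _) hN.le
    have h2 : X r φ ≤ 2 := by
      rw [div_le_iff₀ hN]
      refine (Finset.sum_le_card_nsmul _ _ 2 fun y _ => gap_le_two _ _ _ _).trans ?_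
      rw [nsmul_eq_mul, mul_comm]
    rw [abs_le]
    constructor <;> linarith [meanGap_nonneg (v := v) hβ r, meanGap_le_two (v := v) hβ r]
  have hsqi : Integrable (fun φ => (X r φ - meanGap β v r) ^ 2) (fieldLaw v) := by
    refine Integrable.of_bound (((hXc r).measurable.sub_const _).pow_const 2).aestronglyMeasurable
      4 (Filter.Eventually.of_forall fun φ => ?_)
    rw [Real.norm_eq_abs, abs_pow]
    nlinarith [hb φ, abs_nonneg (X r φ - meanGap β v r)]
  set A := {φ | (∑ y ∈ Q, gap β Q φ y) / Q.card < δ / 2}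
  have hA : MeasurableSet A := measurableSet_lt
    ((continuous_finsetSum _ fun y _ => continuous_gap hβ _ _).div_const _).measurable
    measurable_const
  -- on `A`, the average at scale `r` is below its mean by `δ / 4`, or exceeds the one at scale
  -- `2 L` by `δ / 4`
  have hind : ∀ φ, A.indicator 1 φ ≤ 16 / δ ^ 2 * (X r φ - meanGap β v r) ^ 2
      + 4 / δ * (X r φ - X (2 * L) φ) := by
    intro φ
    have h1 : 0 ≤ 16 / δ ^ 2 * (X r φ - meanGap β v r) ^ 2 := by positivity
    have h2 : 0 ≤ 4 / δ * (X r φ - X (2 * L) φ) :=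
      mul_nonneg (by positivity) (sub_nonneg.2 (hXr φ))
    by_cases hφ : φ ∈ A
    · rw [Set.indicator_of_mem hφ, Pi.one_apply]
      have h3 : X (2 * L) φ < δ / 2 := (hX2 φ).trans_lt hφ
      rcases le_total (X r φ) (3 * δ / 4) with h | h
      · have h4 : (δ / 4) ^ 2 ≤ (X r φ - meanGap β v r) ^ 2 := by
          rw [← neg_sub, neg_sq]
          exact pow_le_pow_left₀ (by positivity) (by linarith) 2
        have h5 : 16 / δ ^ 2 * (δ / 4) ^ 2 = 1 := by field_simp; norm_num
        have h6 : 16 / δ ^ 2 * (δ / 4) ^ 2 ≤ 16 / δ ^ 2 * (X r φ - meanGap β v r) ^ 2 := by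
          gcongr
        linarith
      · have h4 : 4 / δ * (δ / 4) ≤ 4 / δ * (X r φ - X (2 * L) φ) := by
          gcongr
          linarith
        have h5 : 4 / δ * (δ / 4) = 1 := by field_simp
        linarith
    · rw [Set.indicator_of_notMem hφ]
      exact add_nonneg h1 h2
  rw [← integral_indicator_one hA]
  have hi1 := hsqi.const_mul (16 / δ ^ 2)
  have hi2 := ((hXi r).sub (hXi (2 * L))).const_mul (4 / δ)
  refine (integral_mono ((integrable_const (1 : ℝ)).indicator hA) (hi1.add hi2) hind).trans ?_
  have hsplit := integral_add hi1 hi2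
  simp only [Pi.add_apply, Pi.sub_apply] at hsplit ⊢
  rw [hsplit, integral_const_mul, integral_const_mul, integral_sub (hXi r) (hXi _), hXm, hXm]
  have hvar := integral_sq_average_sub_le (v := v) hβ r hQne
  rw [← hcard]
  gcongr

/-- Averages of the gap over a box cannot be bounded below with too high a probability: under
uniform shifts of the field their integral is bounded by the boundary energy. -/
lemma mul_le_of_measure_average_gap_lt_le (hβ : β ≠ ∞) (hv : v ≠ 0) (L : ℕ) {δ T : ℝ}
    (hδ : 0 ≤ δ) (hT : 0 ≤ T)
    (h : (fieldLaw v).real {φ | (∑ y ∈ box 0 L, gap β (box 0 L) φ y) / (box 0 L).card < δ}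
      ≤ Real.exp (-(T ^ 2 * (2 * L + 1) ^ 2 / v)) / 4) :
    T * δ ≤ 16 / (2 * L + 1) := by
  set Q := box 0 L with hQ
  have hcard : (Q.card : ℝ) = (2 * L + 1) ^ 2 := by rw [hQ, card_box]; push_cast; ring
  have hN : (0 : ℝ) < Q.card := by rw [hcard]; positivity
  let g : (Q → ℝ) → ℝ := fun ψ =>
    (∑ x, (meanSpin Q β 1 ψ x - meanSpin Q β (-1) ψ x)) / Q.card
  have hg : Continuous g := (continuous_finsetSum _ fun x _ =>
    (continuous_meanSpin hβ _ _).sub (continuous_meanSpin hβ _ _)).div_const _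
  have hgap : ∀ φ : ℤ × ℤ → ℝ,
      (∑ y ∈ Q, gap β Q φ y) / Q.card = g fun y => φ y := by
    intro φ
    simp only [g]
    rw [← Finset.sum_coe_sort Q]
    simp [gap]
  have hg0 : ∀ ψ, 0 ≤ g ψ := by
    intro ψ
    have h1 := hgap fun y => if h : y ∈ Q then ψ ⟨y, h⟩ else 0
    simp only [Subtype.coe_eta, Finset.coe_mem, dif_pos] at h1
    rw [← h1]
    exact div_nonneg (Finset.sum_nonneg fun y _ => gap_nonneg hβ _ _ _) hN.le
  refine mul_le_of_integral_shift_le hv hg hg0 hT hδ (fun ψ => ?_) ?_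
  · simp only [g]
    rw [intervalIntegral.integral_div]
    have h1 := integral_sum_meanSpin_sub_le hβ ψ (sum_boundary_edges_box_le L 0) T
    rw [div_le_div_iff₀ hN (by positivity), hcard]
    calc _ ≤ 4 * (4 * (2 * (L : ℝ) + 1)) * (2 * L + 1) := by gcongr
      _ = _ := by ring
  · have hm : MeasurableSet {ψ | g ψ < δ} := measurableSet_lt hg.measurable measurable_const
    have h1 : (Measure.pi fun _ : Q => gaussianReal 0 v).real {ψ | g ψ < δ}
        = (fieldLaw v).real {φ | (∑ y ∈ Q, gap β Q φ y) / Q.card < δ} := by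
      have h2 := Measure.infinitePi_map_restrict (X := fun _ : ℤ × ℤ => ℝ)
        (fun _ : ℤ × ℤ => gaussianReal 0 v) (I := Q)
      rw [← h2, map_measureReal_apply (by fun_prop) hm]
      simp only [hgap]
      rfl
    rw [h1, Fintype.card_coe]
    exact h.trans (le_of_eq (by rw [hcard]))

/-! ### The choice of scales -/

/-- Decay of the mean gap: among the `M` scales `2 ^ (i M)`, there is one at which the mean gap
drops by at most `2 / M` up to the next scale. -/
theorem meanGap_sq_mul_log_le (hβ : β ≠ ∞) (hv : v ≠ 0) {M : ℕ} (hM : 1 ≤ M) :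
    meanGap β v (2 ^ M ^ 2) ^ 2 * Real.log M ≤ 6464 * (1 + 1 / v) := by
  set δ := meanGap β v (2 ^ M ^ 2) with hδdef
  have hv' : (0 : ℝ) < v := by exact_mod_cast pos_iff_ne_zero.2 hv
  have hM' : (1 : ℝ) ≤ M := by exact_mod_cast hM
  rcases (meanGap_nonneg (v := v) hβ (2 ^ M ^ 2)).eq_or_lt with h0 | hδ
  · rw [hδdef, ← h0]; simp; positivity
  change 0 < δ at hδ
  have hδ2 : δ ≤ 2 := meanGap_le_two hβ _
  obtain ⟨i, hi, hdiff⟩ : ∃ i ∈ Finset.range M,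
      meanGap β v (2 ^ (i * M)) - meanGap β v (2 ^ ((i + 1) * M)) ≤ 2 / M := by
    refine Finset.exists_le_of_sum_le (Finset.nonempty_range_iff.2 (by omega)) ?_
    rw [Finset.sum_range_sub' (fun i => meanGap β v (2 ^ (i * M)))]
    simp only [Finset.sum_const, Finset.card_range, nsmul_eq_mul]
    rw [mul_div_cancel₀ _ (by positivity)]
    linarith [meanGap_le_two (v := v) hβ (2 ^ (0 * M)), meanGap_nonneg (v := v) hβ (2 ^ (M * M))]
  rw [Finset.mem_range] at hi
  obtain ⟨r, hr⟩ : ∃ r, r = 2 ^ (i * M) := ⟨_, rfl⟩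
  obtain ⟨L, hL⟩ : ∃ L, L = 2 ^ (i * M + (M - 1)) := ⟨_, rfl⟩
  have h2L : 2 * L = 2 ^ M * r := by
    rw [hL, hr, ← pow_add, ← pow_succ']
    congr 1
    omega
  have h2L' : 2 * L = 2 ^ ((i + 1) * M) := by
    rw [h2L, hr, ← pow_add]; congr 1; ring
  have hr1 : 1 ≤ r := hr ▸ Nat.one_le_two_pow
  rw [← hr, ← h2L'] at hdiff
  have hrL : r ≤ 2 * L := by rw [h2L]; exact Nat.le_mul_of_pos_left _ (by positivity)
  have hδL : δ ≤ meanGap β v (2 * L) := by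
    refine meanGap_anti hβ ?_
    rw [h2L', pow_two]
    exact Nat.pow_le_pow_right (by norm_num) (Nat.mul_le_mul_right _ hi)
  have hδr : δ ≤ meanGap β v r := hδL.trans (meanGap_anti hβ hrL)
  have hprob := measure_average_gap_lt_le (v := v) hβ hrL hδ hδr
  -- the probability that the average gap is small decays like `1 / M`
  have hbound : 16 / δ ^ 2 * (4 * (4 * r + 1) ^ 2 / (2 * L + 1) ^ 2)
      + 4 / δ * (meanGap β v r - meanGap β v (2 * L)) ≤ 1616 / (δ ^ 2 * M) := by
    have hr1' : (1 : ℝ) ≤ r := by exact_mod_cast hr1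
    have h2Lr : (2 * L : ℝ) = 2 ^ M * r := by exact_mod_cast h2L
    have hpow : (M : ℝ) ≤ (2 ^ M) ^ 2 := by
      have : M ≤ (2 ^ M) ^ 2 := by
        rw [← pow_mul]
        exact Nat.lt_two_pow_self.le.trans (Nat.pow_le_pow_right (by norm_num) (by omega))
      exact_mod_cast this
    have h1 : 4 * (4 * (r : ℝ) + 1) ^ 2 / (2 * L + 1) ^ 2 ≤ 100 / M := by
      rw [div_le_div_iff₀ (by positivity) (by positivity)]
      have h2 : (4 * (r : ℝ) + 1) ^ 2 ≤ (5 * r) ^ 2 :=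
        pow_le_pow_left₀ (by positivity) (by linarith) 2
      have h3 : (M : ℝ) * r ^ 2 ≤ (2 * L + 1) ^ 2 := by
        calc (M : ℝ) * r ^ 2 ≤ (2 ^ M) ^ 2 * (r : ℝ) ^ 2 := by gcongr
          _ = (2 * (L : ℝ)) ^ 2 := by rw [h2Lr]; ring
          _ ≤ _ := pow_le_pow_left₀ (by positivity) (by linarith) 2
      calc 4 * (4 * (r : ℝ) + 1) ^ 2 * M ≤ 4 * (5 * (r : ℝ)) ^ 2 * (M : ℝ) := by gcongr
        _ = 100 * ((M : ℝ) * (r : ℝ) ^ 2) := by ring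
        _ ≤ _ := by gcongr
    calc _ ≤ 16 / δ ^ 2 * (100 / M) + 4 / δ * (2 / M) := by gcongr
      _ = (1600 + 8 * δ) / (δ ^ 2 * M) := by field_simp; ring
      _ ≤ _ := by gcongr; linarith
  -- shifts by `33 / (δ √v)` standard deviations would contradict the bound on the boundary energy
  have hkey : Real.exp (-(1089 / (δ ^ 2 * v))) / 4 < 1616 / (δ ^ 2 * M) := by
    by_contra! hcon
    have hLpos : (0 : ℝ) < 2 * L + 1 := by positivity
    have hT := mul_le_of_measure_average_gap_lt_le (β := β) hβ hv L (δ := δ / 2)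
      (T := 33 / (δ * (2 * L + 1))) (by positivity) (by positivity)
      (hprob.trans (hbound.trans (hcon.trans (le_of_eq ?_))))
    · rw [div_mul_div_comm, div_le_div_iff₀ (by positivity) hLpos] at hT
      have : 0 < δ * (2 * L + 1) := by positivity
      nlinarith
    · congr 3
      field_simp
      norm_num
  have hMle : (M : ℝ) ≤ 6464 / δ ^ 2 * Real.exp (1089 / (δ ^ 2 * v)) := by
    rw [Real.exp_neg, div_lt_div_iff₀ (by norm_num) (by positivity), inv_mul_lt_iff₀
      (Real.exp_pos _)] at hkey
    rw [div_mul_eq_mul_div, le_div_iff₀ (by positivity)]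
    linarith
  have hlog : Real.log M ≤ 6464 / δ ^ 2 + 1089 / (δ ^ 2 * v) := by
    refine (Real.log_le_log (by linarith) hMle).trans ?_
    rw [Real.log_mul (by positivity) (Real.exp_ne_zero _), Real.log_exp]
    have := Real.log_le_self (x := 6464 / δ ^ 2) (by positivity)
    linarith
  calc δ ^ 2 * Real.log M ≤ δ ^ 2 * (6464 / δ ^ 2 + 1089 / (δ ^ 2 * (v : ℝ))) := by gcongr
    _ = 6464 + 1089 * (1 / (v : ℝ)) := by field_simp
    _ ≤ _ := by
      have : 0 < 1 / (v : ℝ) := by positivity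
      linarith

/-! ### Zero temperature as a limit -/

lemma tendsto_meanSpin_top (γ : BoundaryCondition Λ) (φ : Λ → ℝ) (x : Λ) :
    Filter.Tendsto (fun k : ℕ => meanSpin Λ k γ φ x) Filter.atTop
      (nhds (meanSpin Λ ∞ γ φ x)) := by
  obtain ⟨σ₀, hσ₀⟩ := Finite.exists_min (energy Λ γ φ)
  set m := energy Λ γ φ σ₀
  -- weights normalized so that the ground states have weight `1`
  have hu : ∀ σ, Filter.Tendsto (fun k : ℕ => Real.exp (k * m) * weight Λ k γ φ σ) Filter.atTop
      (nhds (weight Λ ∞ γ φ σ)) := by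
    intro σ
    have h1 : ∀ k : ℕ, Real.exp (k * m) * weight Λ k γ φ σ
        = Real.exp (-(energy Λ γ φ σ - m)) ^ k := by
      intro k
      rw [weight_of_ne_top (ENNReal.natCast_ne_top k), ← Real.exp_add, ← Real.exp_nat_mul,
        ENNReal.toReal_natCast]
      congr 1
      ring
    simp only [h1]
    rcases (hσ₀ σ).eq_or_lt with h | h
    · have h2 : weight Λ ∞ γ φ σ = 1 := by
        simp only [weight, if_true]
        rw [if_pos fun τ => h ▸ hσ₀ τ]
      have h3 : energy Λ γ φ σ - m = 0 := sub_eq_zero.2 h.symm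
      simp [h2, h3]
    · have h2 : weight Λ ∞ γ φ σ = 0 := by
        simp only [weight, if_true]
        rw [if_neg fun h' => absurd (h' σ₀) (not_le.2 h)]
      rw [h2]
      refine tendsto_pow_atTop_nhds_zero_of_lt_one (Real.exp_nonneg _) ?_
      rw [Real.exp_lt_one_iff]
      linarith
  have h : ∀ k : ℕ, meanSpin Λ k γ φ x
      = (∑ σ, Real.exp (k * m) * weight Λ k γ φ σ * spin (σ x))
        / ∑ σ, Real.exp (k * m) * weight Λ k γ φ σ := by
    intro k
    rw [meanSpin_eq_div, partitionFn]
    simp only [mul_assoc, ← Finset.mul_sum]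
    rw [mul_div_mul_left _ _ (Real.exp_ne_zero _)]
  simp only [h]
  rw [meanSpin_eq_div]
  exact Filter.Tendsto.div (tendsto_finsetSum _ fun σ _ => (hu σ).mul_const _)
    (tendsto_finsetSum _ fun σ _ => hu σ) (partitionFn_pos _ _ _).ne'

lemma measurable_meanSpin (β : ℝ≥0∞) (γ : BoundaryCondition Λ) (x : Λ) :
    Measurable fun φ : Λ → ℝ => meanSpin Λ β γ φ x := by
  by_cases hβ : β = ∞
  · subst hβ
    exact measurable_of_tendsto_metrizable
      (fun k : ℕ => (continuous_meanSpin (ENNReal.natCast_ne_top k) γ x).measurable)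
      (tendsto_pi_nhds.2 fun φ => tendsto_meanSpin_top γ φ x)
  · exact (continuous_meanSpin hβ γ x).measurable

lemma boundaryEffect_eq_sup' (β : ℝ≥0∞) (φ : Λ → ℝ) (x : Λ) :
    boundaryEffect Λ β φ x = Finset.univ.sup' Finset.univ_nonempty
      fun p : BoundaryCondition Λ × BoundaryCondition Λ =>
        |meanSpin Λ β p.1 φ x - meanSpin Λ β p.2 φ x| :=
  (Finset.sup'_univ_eq_ciSup _).symm

lemma measurable_boundaryEffect (β : ℝ≥0∞) (x : Λ) :
    Measurable fun φ : Λ → ℝ => boundaryEffect Λ β φ x := by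
  refine Measurable.iSup fun p => ?_
  exact ((measurable_meanSpin β _ x).sub (measurable_meanSpin β _ x)).abs

lemma tendsto_boundaryEffect_top (φ : Λ → ℝ) (x : Λ) :
    Filter.Tendsto (fun k : ℕ => boundaryEffect Λ k φ x) Filter.atTop
      (nhds (boundaryEffect Λ ∞ φ x)) := by
  simp only [boundaryEffect_eq_sup']
  refine Filter.Tendsto.finset_sup'_nhds_apply _ fun p _ => ?_
  exact ((tendsto_meanSpin_top _ _ _).sub (tendsto_meanSpin_top _ _ _)).abs

lemma boundaryEffect_nonneg (β : ℝ≥0∞) (φ : Λ → ℝ) (x : Λ) : 0 ≤ boundaryEffect Λ β φ x :=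
  Real.iSup_nonneg fun _ => abs_nonneg _

lemma boundaryEffect_le_two (β : ℝ≥0∞) (φ : Λ → ℝ) (x : Λ) : boundaryEffect Λ β φ x ≤ 2 :=
  ciSup_le fun p => (abs_sub _ _).trans (by
    linarith [abs_meanSpin_le_one β p.1 φ x, abs_meanSpin_le_one β p.2 φ x])

/-! ### The bound at a given distance from the boundary -/

lemma box_subset_of_lt_infDist {x : ℤ × ℤ} (hx : x ∈ Λ) {R : ℕ}
    (hR : (R : ℝ) < Metric.infDist x (outerBoundary Λ : Set (ℤ × ℤ))) : box x R ⊆ Λ := by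
  -- induction on the `ℓ¹` distance: the first site outside `Λ` on a path would be in `∂Λ`
  have key : ∀ d : ℕ, ∀ z ∈ box x R, |z.1 - x.1| + |z.2 - x.2| = d → z ∈ Λ := by
    intro d
    induction d with
    | zero =>
      intro z _ hd
      have h1 := abs_nonneg (z.1 - x.1)
      have h2 := abs_nonneg (z.2 - x.2)
      have h3 : |z.1 - x.1| = 0 := by push_cast at hd; omega
      have h4 : |z.2 - x.2| = 0 := by push_cast at hd; omega
      rw [abs_eq_zero, sub_eq_zero] at h3 h4
      exact Prod.ext h3 h4 ▸ hx
    | succ d ih =>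
      intro z hz hd
      obtain ⟨w, hw, hwz, hwd⟩ : ∃ w ∈ box x R, z ∈ neighbors w
          ∧ |w.1 - x.1| + |w.2 - x.2| = d := by
        obtain ⟨a, b⟩ := z
        rw [mem_box] at hz
        dsimp only at hz hd
        push_cast at hd
        have hne : a < x.1 ∨ x.1 < a ∨ b < x.2 ∨ x.2 < b := by
          by_contra! h
          have h1 : a - x.1 = 0 := by omega
          have h2 : b - x.2 = 0 := by omega
          rw [h1, h2, abs_zero] at hd
          omega
        rcases hne with h | h | h | h
        · refine ⟨(a + 1, b), by rw [mem_box]; dsimp only; omega, by simp [neighbors], ?_⟩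
          rw [abs_of_neg (by omega : a - x.1 < 0)] at hd
          dsimp only
          rw [abs_of_nonpos (by omega : a + 1 - x.1 ≤ 0)]
          omega
        · refine ⟨(a - 1, b), by rw [mem_box]; dsimp only; omega, by simp [neighbors], ?_⟩
          rw [abs_of_pos (by omega : 0 < a - x.1)] at hd
          dsimp only
          rw [abs_of_nonneg (by omega : 0 ≤ a - 1 - x.1)]
          omega
        · refine ⟨(a, b + 1), by rw [mem_box]; dsimp only; omega, by simp [neighbors], ?_⟩
          rw [abs_of_neg (by omega : b - x.2 < 0)] at hd
          dsimp only
          rw [abs_of_nonpos (by omega : b + 1 - x.2 ≤ 0)]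
          omega
        · refine ⟨(a, b - 1), by rw [mem_box]; dsimp only; omega, by simp [neighbors], ?_⟩
          rw [abs_of_pos (by omega : 0 < b - x.2)] at hd
          dsimp only
          rw [abs_of_nonneg (by omega : 0 ≤ b - 1 - x.2)]
          omega
      by_contra hzΛ
      have hzb : z ∈ outerBoundary Λ := mem_outerBoundary.2 ⟨hzΛ, w, ih w hw hwd, hwz⟩
      have h1 : Metric.infDist x (outerBoundary Λ : Set (ℤ × ℤ)) ≤ dist x z :=
        Metric.infDist_le_dist_of_mem (Finset.mem_coe.2 hzb)
      have h2 : dist x z ≤ R := by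
        rw [mem_box] at hz
        rw [Prod.dist_eq, Int.dist_eq, Int.dist_eq]
        have h3 : |x.1 - z.1| ≤ R := by rw [abs_le]; omega
        have h4 : |x.2 - z.2| ≤ R := by rw [abs_le]; omega
        exact max_le (by exact_mod_cast h3) (by exact_mod_cast h4)
      linarith
  intro z hz
  exact key (|z.1 - x.1| + |z.2 - x.2|).toNat z hz
    (Int.toNat_of_nonneg (by positivity)).symm

section Law

variable {Ω : Type*} [MeasurableSpace Ω] {P : Measure Ω} [IsProbabilityMeasure P]
  {φ : Λ → Ω → ℝ}

lemma integrable_boundaryEffect (hφ : ∀ y : Λ, AEMeasurable (φ y) P) (β : ℝ≥0∞) (x : Λ) :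
    Integrable (fun ω => boundaryEffect Λ β (fun y => φ y ω) x) P := by
  refine Integrable.of_bound ((measurable_boundaryEffect β x).comp_aemeasurable
    (aemeasurable_pi_lambda _ hφ)).aestronglyMeasurable 2 (Filter.Eventually.of_forall fun ω => ?_)
  rw [Real.norm_eq_abs, abs_of_nonneg (boundaryEffect_nonneg _ _ _)]
  exact boundaryEffect_le_two _ _ _

lemma integral_boundaryEffect_le_meanGap (hβ : β ≠ ∞) (hind : iIndepFun φ P)
    (hlaw : ∀ y : Λ, HasLaw (φ y) (gaussianReal 0 v) P) (x : Λ) {R : ℕ} (hR : box x R ⊆ Λ) :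
    ∫ ω, boundaryEffect Λ β (fun y => φ y ω) x ∂P ≤ meanGap β v R := by
  let e : (Λ → ℝ) → ℤ × ℤ → ℝ := fun ψ y => if h : y ∈ Λ then ψ ⟨y, h⟩ else 0
  have he : Continuous e := continuous_pi fun y => by
    by_cases h : y ∈ Λ
    · simp only [e, h, dif_pos]; fun_prop
    · simp only [e, h, dif_neg, not_false_eq_true]; fun_prop
  have hF : Continuous fun ψ => gap β (box x R) (e ψ) x := (continuous_gap hβ _ _).comp he
  have hpi := hind.hasLaw_pi hlaw
  have h1 : ∀ ω, boundaryEffect Λ β (fun y => φ y ω) x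
      ≤ gap β (box x R) (e fun y => φ y ω) x := by
    intro ω
    have h2 := boundaryEffect_le_gap hβ hR (e fun y => φ y ω) (self_mem_box (x : ℤ × ℤ) R)
    have h3 : (fun y : Λ => e (fun y => φ y ω) y) = fun y => φ y ω := by
      ext y; simp [e]
    rw [h3] at h2
    exact h2
  have h4 : ∫ ω, gap β (box x R) (e fun y => φ y ω) x ∂P = meanGap β v R := by
    rw [← integral_gap_box hβ R x]
    have h5 := integral_map (μ := P) hpi.aemeasurable
      (f := fun ψ => gap β (box x R) (e ψ) x) hF.measurable.aestronglyMeasurable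
    rw [hpi.map_eq] at h5
    rw [← h5, ← integral_restrict_infinitePi (X := fun _ : ℤ × ℤ => ℝ)
      (fun _ : ℤ × ℤ => gaussianReal 0 v) hF.measurable.aestronglyMeasurable]
    refine integral_congr_ae (Filter.Eventually.of_forall fun χ => ?_)
    exact gap_congr (fun y hy => by simp [e, hR hy]) x
  rw [← h4]
  refine integral_mono (integrable_boundaryEffect (fun y => (hlaw y).aemeasurable) β x) ?_ h1
  refine Integrable.of_bound (hF.measurable.comp_aemeasurable hpi.aemeasurable).aestronglyMeasurable
    2 (Filter.Eventually.of_forall fun ω => ?_)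
  rw [Real.norm_eq_abs, abs_of_nonneg (gap_nonneg hβ _ _ _)]
  exact gap_le_two _ _ _ _

end Law

/-- The scale `2 ^ M ^ 2` is the largest of its kind below `n`, so that `log log n` is comparable
to `log M`. -/
lemma exists_scale {n : ℝ} (hn : 3 ≤ n) :
    ∃ M : ℕ, 1 ≤ M ∧ (2 : ℝ) ^ M ^ 2 < n ∧ Real.log (Real.log n) ≤ 2 * (Real.log M + 1) := by
  have hex : ∃ k : ℕ, n ≤ (2 : ℝ) ^ k ^ 2 := by
    obtain ⟨k, hk⟩ := pow_unbounded_of_one_lt n (one_lt_two : (1 : ℝ) < 2)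
    exact ⟨k, hk.le.trans (pow_le_pow_right₀ one_le_two (Nat.le_self_pow two_ne_zero k))⟩
  classical
  obtain ⟨k, hk⟩ : ∃ k, k = Nat.find hex := ⟨_, rfl⟩
  have hkn : n ≤ (2 : ℝ) ^ k ^ 2 := hk ▸ Nat.find_spec hex
  have hk2 : 2 ≤ k := by
    by_contra! h
    interval_cases k <;> norm_num at hkn <;> linarith
  obtain ⟨M, rfl⟩ : ∃ M, k = M + 1 := ⟨k - 1, by omega⟩
  have hM : 1 ≤ M := by omega
  have hM' : (1 : ℝ) ≤ M := by exact_mod_cast hM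
  refine ⟨M, hM, not_le.1 (Nat.find_min hex (by omega)), ?_⟩
  have hlog : 0 < Real.log n := Real.log_pos (by linarith)
  have h1 : Real.log n ≤ ((M : ℝ) + 1) ^ 2 := by
    have h2 := Real.log_le_log (by linarith) hkn
    rw [Real.log_pow] at h2
    push_cast at h2
    nlinarith [Real.log_two_lt_d9, sq_nonneg ((M : ℝ) + 1)]
  have h3 := Real.log_le_log hlog h1
  rw [Real.log_pow] at h3
  have h4 : Real.log ((M : ℝ) + 1) ≤ Real.log (2 * M) :=
    Real.log_le_log (by linarith) (by linarith)
  rw [Real.log_mul two_ne_zero (by linarith)] at h4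
  push_cast at h3
  linarith [Real.log_two_lt_d9]

/-- The bound on the mean gap in terms of the distance `n`. -/
lemma exists_meanGap_le {v : ℝ≥0} (hβ : β ≠ ∞) (hv : v ≠ 0) {n : ℝ} (hn : 3 ≤ n) :
    ∃ R : ℕ, (R : ℝ) < n ∧
      meanGap β v R ≤ 114 * (1 + (v : ℝ) ^ (-1 / 2 : ℝ)) / √(Real.log (Real.log n)) := by
  obtain ⟨M, hM, hMn, hlog⟩ := exists_scale hn
  refine ⟨2 ^ M ^ 2, by exact_mod_cast hMn, ?_⟩
  have hv' : (0 : ℝ) < v := by exact_mod_cast pos_iff_ne_zero.2 hv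
  have hlog3 : 1 < Real.log n := by
    rw [Real.lt_log_iff_exp_lt (by linarith)]
    linarith [Real.exp_one_lt_d9]
  have hll : 0 < Real.log (Real.log n) := Real.log_pos hlog3
  have h := meanGap_sq_mul_log_le hβ hv hM
  have h0 := meanGap_nonneg (v := v) hβ (2 ^ M ^ 2)
  have h2 := meanGap_le_two (v := v) hβ (2 ^ M ^ 2)
  set a := meanGap β v (2 ^ M ^ 2)
  set u := (v : ℝ) ^ (-1 / 2 : ℝ)
  have hu : 0 < u := Real.rpow_pos_of_pos hv' _
  have hu2 : 1 / (v : ℝ) = u ^ 2 := by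
    rw [← Real.rpow_natCast, ← Real.rpow_mul hv'.le]
    norm_num [Real.rpow_neg_one]
  rw [hu2] at h
  rw [le_div_iff₀ (Real.sqrt_pos.2 hll)]
  refine le_of_sq_le_sq ?_ (by positivity)
  rw [mul_pow, Real.sq_sqrt hll.le]
  have h3 : a ^ 2 * Real.log (Real.log n) ≤ a ^ 2 * (2 * (Real.log M + 1)) := by gcongr
  nlinarith

end RFIM

end

/-- The distance on `ℤ × ℤ` is the `ℓ^∞` distance. -/
theorem theorem1 :
    ∃ C : ℝ, ∀ (Ω : Type*) [MeasurableSpace Ω] (P : Measure Ω) [IsProbabilityMeasure P]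
      (Λ : Finset (ℤ × ℤ)) (β : ℝ≥0∞) (v : ℝ≥0) (φ : Λ → Ω → ℝ) (x : Λ) (n : ℝ),
      0 < v →
      iIndepFun φ P →
      (∀ y : Λ, HasLaw (φ y) (gaussianReal 0 v) P) →
      n = Metric.infDist (x : ℤ × ℤ) (RFIM.outerBoundary Λ : Set (ℤ × ℤ)) →
      3 ≤ n →
      Integrable (fun ω => RFIM.boundaryEffect Λ β (fun y => φ y ω) x) P ∧
      ∫ ω, RFIM.boundaryEffect Λ β (fun y => φ y ω) x ∂P
        ≤ C * (1 + (v : ℝ) ^ (-1 / 2 : ℝ)) / √(Real.log (Real.log n)) := by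
  refine ⟨114, fun Ω _ P _ Λ β v φ x n hv hind hlaw hn hn3 => ?_⟩
  have hint := fun β' => RFIM.integrable_boundaryEffect (fun y => (hlaw y).aemeasurable) β' x
  refine ⟨hint β, ?_⟩
  have hfin : ∀ β' : ℝ≥0∞, β' ≠ ∞ → ∫ ω, RFIM.boundaryEffect Λ β' (fun y => φ y ω) x ∂P
      ≤ 114 * (1 + (v : ℝ) ^ (-1 / 2 : ℝ)) / √(Real.log (Real.log n)) := by
    intro β' hβ'
    obtain ⟨R, hRn, hR⟩ := RFIM.exists_meanGap_le hβ' hv.ne' hn3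
    exact (RFIM.integral_boundaryEffect_le_meanGap hβ' hind hlaw x
      (RFIM.box_subset_of_lt_infDist x.2 (hn ▸ hRn))).trans hR
  by_cases hβ : β = ∞
  · subst hβ
    refine le_of_tendsto (tendsto_integral_of_dominated_convergence (fun _ => (2 : ℝ))
      (fun k : ℕ => (hint k).aestronglyMeasurable) (integrable_const _)
      (fun k => Filter.Eventually.of_forall fun ω => ?_)
      (Filter.Eventually.of_forall fun ω => RFIM.tendsto_boundaryEffect_top _ x))
      (Filter.Eventually.of_forall fun k => hfin k (ENNReal.natCast_ne_top k))
    rw [Real.norm_eq_abs, abs_of_nonneg (RFIM.boundaryEffect_nonneg _ _ _)]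
    exact RFIM.boundaryEffect_le_two _ _ _
  · exact hfin β hβ
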